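/- Let $k$ be a field of characteristic $0$ and $n\ge 1$. For an associative ring $A$ with a derivation $d$, let $A((\partial^{-1}))$ be the ring of formal pseudo-differential operators $\sum_{i\le N}a_i\partial^i$ ($a_i\in A$, $N \in \mathbb{Z}$) with the multiplication $$\Big(\sum_i a_i\partial^i\Big)\Big(\sum_j b_j\partial^j\Big)=\sum_{i,j;\,m\ge 0}\binom{i}{m}a_i\,d^m(b_j)\,\partial^{i+j-m}.$$ Let $E=k[[x_1,\dots,x_n]]((\partial_1^{-1}))\cdots((\partial_n^{-1}))$ be the ring obtained by iterating this construction, where at the $i$-th step the derivation is $\partial/\partial x_i$, extended coefficientwise. Let $E_-\subset E$ be the set of operators that contain only negative powers of $\partial_n$. Let $L_1,\dots,L_n\in E$ with $L_i\in\partial_i+E_-$ for all $i$ and $[L_i,L_j]=0$ for all $i,j$. Then the ring $Z(L_1,\dots,L_n)\subset E$ of all operators in $E$ that commute with every $L_i$ is commutative and equals $k((L_1^{-1}))\cdots((L_n^{-1}))$. That is: every $L_i$ is invertible in $E$; for every iterated Laurent series $c=\sum_\alpha c_\alpha z^\alpha\in k((z_1))\cdots((z_n))$ the series $\sum_\alpha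 c_\alpha L_1^{-\alpha_1}\cdots L_n^{-\alpha_n}$ converges in $E$ coefficientwise (for each $\beta\in\mathbb{Z}^n$, only finitely many terms have a nonzero coefficient at $\partial_1^{\beta_1}\cdots\partial_n^{\beta_n}$, and the resulting coefficients are those of an element of $E$); the map sending $c$ to this sum is a ring homomorphism $k((z_1))\cdots((z_n))\to E$; and $Z(L_1,\dots,L_n)$ is the set of all these sums. -/

import Mathlib

universe u v

/-- A derivation of an associative (not necessarily commutative) ring. -/
structure RingDer (A : Type u) [Ring A] extends A →+ A where
  leibniz' : ∀ a b : A, toFun (a * b) = toFun a * b + a * toFun b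

namespace RingDer

variable {A : Type u} [Ring A]

instance : FunLike (RingDer A) A A where
  coe d := d.toFun
  coe_injective d e h := by
    cases d; cases e; congr; exact DFunLike.coe_injective h

instance : AddMonoidHomClass (RingDer A) A A where
  map_add d := d.map_add'
  map_zero d := d.map_zero'

theorem leibniz (d : RingDer A) (a b : A) : d (a * b) = d a * b + a * d b := d.leibniz' a b

theorem iter_add (d : RingDer A) (k : ℕ) (a b : A) : d^[k] (a + b) = d^[k] a + d^[k] b :=
  iterate_map_add d k a b

theorem iter_zero (d : RingDer A) (k : ℕ) : d^[k] (0 : A) = 0 := iterate_map_zero d k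

theorem iter_zsmul (d : RingDer A) (k : ℕ) (n : ℤ) (a : A) : d^[k] (n • a) = n • d^[k] a :=
  by
  induction k with
  | zero => rfl
  | succ k ih => rw [Function.iterate_succ_apply', ih, map_zsmul, Function.iterate_succ_apply']

theorem map_one (d : RingDer A) : d 1 = 0 := by
  have h := d.leibniz 1 1
  simpa using h

theorem iter_leibniz (d : RingDer A) (q : ℕ) (a b : A) :
    d^[q] (a * b) = ∑ p ∈ Finset.HasAntidiagonal.antidiagonal q, q.choose p.1 • (d^[p.1] a * d^[p.2] b) := by
  induction q with
  | zero => simp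
  | succ q ih =>
    rw [Function.iterate_succ_apply', ih, map_sum,
      Finset.sum_antidiagonal_choose_succ_nsmul (fun i j => d^[i] a * d^[j] b),
      ← Finset.sum_add_distrib]
    refine Finset.sum_congr rfl fun p hp => ?_
    have h2 : q.choose p.2 = q.choose p.1 :=
      Nat.choose_symm_of_eq_add (by rw [Finset.HasAntidiagonal.mem_antidiagonal] at hp; omega)
    rw [map_nsmul, leibniz, h2, ← smul_add, Function.iterate_succ_apply',
      Function.iterate_succ_apply', add_comm]

end RingDer

/-- The two-sided sequences `(a_i)` that vanish for all large `i`, i.e. the coefficients of the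
formal expressions `∑_{i ≤ N} a_i ∂ ^ i`. -/
def boundedAbove (A : Type u) [Ring A] : AddSubgroup (ℤ → A) where
  carrier := {f | ∃ N : ℤ, ∀ i, N < i → f i = 0}
  zero_mem' := ⟨0, fun _ _ => rfl⟩
  add_mem' := by
    rintro f g ⟨N, hN⟩ ⟨M, hM⟩
    refine ⟨max N M, fun i hi => ?_⟩
    simp [hN i (lt_of_le_of_lt (le_max_left _ _) hi), hM i (lt_of_le_of_lt (le_max_right _ _) hi)]
  neg_mem' := by
    rintro f ⟨N, hN⟩
    exact ⟨N, fun i hi => by simp [hN i hi]⟩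

/-- The ring `A((∂⁻¹))` of formal pseudo-differential operators `∑_{i ≤ N} a_i ∂ ^ i` with
coefficients in `A`, where `∂` acts on `A` as the derivation `d`. -/
def PsDO {A : Type u} [Ring A] (_d : RingDer A) : Type u := boundedAbove A

theorem finsum_eq_comp {α β M : Type*} [AddCommMonoid M] (F : β → M) (e : α → β)
    (he : Function.Injective e) (h : ∀ b, b ∉ Set.range e → F b = 0) :
    ∑ᶠ b, F b = ∑ᶠ a, F (e a) := by
  classical
  rw [← finsum_mem_range he]
  refine finsum_congr fun b => ?_
  by_cases hb : b ∈ Set.range e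
  · exact (finsum_eq_if.trans (if_pos hb)).symm
  · rw [h b hb]; exact (finsum_eq_if.trans (if_neg hb)).symm

namespace PsDO

variable {A : Type u} [Ring A] {d : RingDer A}

noncomputable instance : AddCommGroup (PsDO d) := inferInstanceAs (AddCommGroup (boundedAbove A))

/-- The coefficient of `∂ ^ i`. -/
def coeff (f : PsDO d) (i : ℤ) : A := f.1 i

/-- The operator with given coefficients. -/
def ofCoeff (f : ℤ → A) (h : ∃ N : ℤ, ∀ i, N < i → f i = 0) : PsDO d := ⟨f, h⟩

@[simp] theorem coeff_ofCoeff (f : ℤ → A) (h : ∃ N : ℤ, ∀ i, N < i → f i = 0) (i : ℤ) :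
    (ofCoeff f h : PsDO d).coeff i = f i := rfl

theorem bdd (f : PsDO d) : ∃ N : ℤ, ∀ i, N < i → f.coeff i = 0 := f.2

@[ext] theorem ext {f g : PsDO d} (h : ∀ i, f.coeff i = g.coeff i) : f = g :=
  Subtype.ext (funext h)

@[simp] theorem coeff_zero (i : ℤ) : (0 : PsDO d).coeff i = 0 := rfl

@[simp] theorem coeff_add (f g : PsDO d) (i : ℤ) : (f + g).coeff i = f.coeff i + g.coeff i := rfl

@[simp] theorem coeff_neg (f : PsDO d) (i : ℤ) : (-f).coeff i = -f.coeff i := rfl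

@[simp] theorem coeff_sub (f g : PsDO d) (i : ℤ) : (f - g).coeff i = f.coeff i - g.coeff i := rfl

/-- The operator `a ∂ ^ i`. -/
noncomputable def single (i : ℤ) (a : A) : PsDO d :=
  ofCoeff (fun j => if j = i then a else 0) ⟨i, fun _ hj => if_neg hj.ne'⟩

theorem coeff_single (i : ℤ) (a : A) (j : ℤ) :
    (single i a : PsDO d).coeff j = if j = i then a else 0 := rfl

/-- The coefficient of `∂ ^ n` in
`(∑ a_i ∂ ^ i) (∑ b_j ∂ ^ j) = ∑_{i, j, k ≥ 0} (i choose k) a_i d ^ k (b_j) ∂ ^ (i + j - k)`.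
The sum is over the pairs `(i, k)`, and `j = n - i + k`; it has only finitely many nonzero terms. -/
noncomputable def mulCoeff (f g : PsDO d) (n : ℤ) : A :=
  ∑ᶠ p : ℤ × ℕ, Ring.choose p.1 p.2 • (f.coeff p.1 * d^[p.2] (g.coeff (n - p.1 + p.2)))

theorem mul_support (f g : PsDO d) (n : ℤ) :
    (Function.support fun p : ℤ × ℕ =>
      Ring.choose p.1 p.2 • (f.coeff p.1 * d^[p.2] (g.coeff (n - p.1 + p.2)))).Finite := by
  obtain ⟨N, hN⟩ := f.bdd
  obtain ⟨M, hM⟩ := g.bdd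
  refine ((Finset.Icc (n - M) N) ×ˢ (Finset.range (M - n + N + 1).toNat)).finite_toSet.subset ?_
  intro p hp
  have h1 : p.1 ≤ N := by
    by_contra h
    exact hp (by simp [hN p.1 (not_le.mp h)])
  have h2 : n - p.1 + p.2 ≤ M := by
    by_contra h
    exact hp (by simp [hM _ (not_le.mp h)])
  simp only [Finset.coe_product, Set.mem_prod, Finset.coe_Icc, Set.mem_Icc, Finset.coe_range,
    Set.mem_Iio]
  omega

theorem mulCoeff_of_lt {f g : PsDO d} {N M : ℤ} (hN : ∀ i, N < i → f.coeff i = 0)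
    (hM : ∀ i, M < i → g.coeff i = 0) {n : ℤ} (hn : N + M < n) : mulCoeff f g n = 0 := by
  refine finsum_eq_zero_of_forall_eq_zero fun p => ?_
  by_cases h : N < p.1
  · simp [hN _ h]
  · rw [hM (n - p.1 + p.2) (by omega), RingDer.iter_zero]
    simp

noncomputable instance : Mul (PsDO d) where
  mul f g := ofCoeff (mulCoeff f g) (by
    obtain ⟨N, hN⟩ := f.bdd
    obtain ⟨M, hM⟩ := g.bdd
    exact ⟨N + M, fun _ hn => mulCoeff_of_lt hN hM hn⟩)

noncomputable instance : One (PsDO d) := ⟨single 0 1⟩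

theorem coeff_mul (f g : PsDO d) (n : ℤ) : (f * g).coeff n =
    ∑ᶠ p : ℤ × ℕ, Ring.choose p.1 p.2 • (f.coeff p.1 * d^[p.2] (g.coeff (n - p.1 + p.2))) := rfl

theorem coeff_mul_of_lt {f g : PsDO d} {N M : ℤ} (hN : ∀ i, N < i → f.coeff i = 0)
    (hM : ∀ i, M < i → g.coeff i = 0) {n : ℤ} (hn : N + M < n) : (f * g).coeff n = 0 :=
  mulCoeff_of_lt hN hM hn

protected theorem left_distrib (f g h : PsDO d) : f * (g + h) = f * g + f * h := by
  ext n
  rw [coeff_add, coeff_mul, coeff_mul, coeff_mul,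
    ← finsum_add_distrib (mul_support f g n) (mul_support f h n)]
  refine finsum_congr fun p => ?_
  rw [coeff_add, RingDer.iter_add, mul_add, smul_add]

protected theorem right_distrib (f g h : PsDO d) : (f + g) * h = f * h + g * h := by
  ext n
  rw [coeff_add, coeff_mul, coeff_mul, coeff_mul,
    ← finsum_add_distrib (mul_support f h n) (mul_support g h n)]
  refine finsum_congr fun p => ?_
  rw [coeff_add, add_mul, smul_add]

theorem coeff_single_mul (i : ℤ) (a : A) (g : PsDO d) (n : ℤ) : (single i a * g).coeff n =
    ∑ᶠ k : ℕ, Ring.choose i k • (a * d^[k] (g.coeff (n - i + k))) := by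
  rw [coeff_mul, finsum_eq_comp _ (fun k : ℕ => ((i, k) : ℤ × ℕ)) fun _ _ h => (Prod.mk.inj h).2]
  · simp [coeff_single]
  · rintro ⟨j, k⟩ h
    have : j ≠ i := by rintro rfl; exact h ⟨k, rfl⟩
    simp [coeff_single, this]

theorem coeff_mul_single (f : PsDO d) (l : ℤ) (c : A) (n : ℤ) : (f * single l c).coeff n =
    ∑ᶠ k : ℕ, Ring.choose (n - l + k) k • (f.coeff (n - l + k) * d^[k] c) := by
  rw [coeff_mul, finsum_eq_comp _ (fun k : ℕ => ((n - l + k, k) : ℤ × ℕ))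
    fun _ _ h => (Prod.mk.inj h).2]
  · refine finsum_congr fun k => ?_
    have : n - (n - l + k) + k = l := by ring
    simp [coeff_single, this]
  · rintro ⟨j, k⟩ h
    have : ¬ n - j + k = l := by
      rintro rfl
      exact h ⟨k, Prod.ext (by dsimp only; ring) rfl⟩
    simp [coeff_single, this]

theorem coeff_single_mul_single (i j : ℤ) (a b : A) (k : ℕ) :
    (single i a * single j b : PsDO d).coeff (i + j - k) = Ring.choose i k • (a * d^[k] b) := by
  rw [coeff_single_mul, finsum_eq_single _ k]
  · have : i + j - k - i + k = j := by ring
    simp [coeff_single, this]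
  · intro m hm
    have : ¬ (i + j - k - i + m = j) := by omega
    simp [coeff_single, this]

theorem coeff_single_mul_single_of_lt (i j : ℤ) (a b : A) (n : ℤ) (h : i + j < n) :
    (single i a * single j b : PsDO d).coeff n = 0 :=
  coeff_mul_of_lt (N := i) (M := j) (fun m hm => by simp [coeff_single, hm.ne'])
    (fun m hm => by simp [coeff_single, hm.ne']) h

theorem choose_identity (i j : ℤ) (r m : ℕ) :
    ∑ p ∈ Finset.HasAntidiagonal.antidiagonal m,
      Ring.choose i (r + p.1) * Ring.choose j p.2 * ((r + p.1).choose r : ℤ) =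
    Ring.choose i r * Ring.choose (i + j - r) m := by
  have h : i + j - r = (i - r) + j := by ring
  rw [h, Ring.add_choose_eq m (Commute.all _ _), Finset.mul_sum]
  refine Finset.sum_congr rfl fun p _ => ?_
  have := Ring.choose_smul_choose i (Nat.le_add_right r p.1)
  rw [Nat.add_sub_cancel_left, nsmul_eq_mul] at this
  linear_combination (Ring.choose j p.2) * this

theorem assoc_single (i j l : ℤ) (a b c : A) :
    (single i a * single j b * single l c : PsDO d) =
      single i a * (single j b * single l c) := by
  ext n
  by_cases hn : i + j + l < n
  · rw [coeff_mul_of_lt (N := i + j) (M := l) (coeff_single_mul_single_of_lt i j a b)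
      (fun m hm => by simp [coeff_single, hm.ne']) hn,
      coeff_mul_of_lt (N := i) (M := j + l) (fun m hm => by simp [coeff_single, hm.ne'])
      (coeff_single_mul_single_of_lt j l b c) (by omega)]
  obtain ⟨N, hN⟩ : ∃ N : ℕ, i + j + l - n = N := ⟨(i + j + l - n).toNat, by omega⟩
  obtain rfl : n = i + j + l - N := by omega
  have hL : (single i a * single j b * single l c : PsDO d).coeff (i + j + l - N) =
      ∑ p ∈ Finset.HasAntidiagonal.antidiagonal N,
        (Ring.choose i p.1 * Ring.choose (i + j - p.1) p.2) • (a * (d^[p.1] b * d^[p.2] c)) := by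
    rw [coeff_mul_single, finsum_eq_sum_of_support_subset (s := Finset.range (N + 1)),
      Finset.Nat.sum_antidiagonal_eq_sum_range_succ_mk, ← Finset.sum_range_reflect]
    · refine Finset.sum_congr rfl fun m hm => ?_
      have hm' : m ≤ N := by simpa [Nat.lt_succ_iff] using hm
      have e1 : N + 1 - 1 - m = N - m := by omega
      have e2 : i + j + l - N - l + ((N - m : ℕ) : ℤ) = i + j - m := by omega
      rw [e1, e2, coeff_single_mul_single, smul_mul_assoc, smul_smul, mul_assoc, mul_comm]
    · intro m hm
      simp only [Finset.coe_range, Set.mem_Iio]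
      by_contra h
      exact hm (by simp [coeff_single_mul_single_of_lt i j a b (i + j + l - N - l + m) (by omega)])
  have hR : (single i a * (single j b * single l c) : PsDO d).coeff (i + j + l - N) =
      ∑ p ∈ Finset.HasAntidiagonal.antidiagonal N,
        (Ring.choose i p.1 * Ring.choose j p.2) • (a * d^[p.1] (b * d^[p.2] c)) := by
    rw [coeff_single_mul, finsum_eq_sum_of_support_subset (s := Finset.range (N + 1)),
      Finset.Nat.sum_antidiagonal_eq_sum_range_succ_mk]
    · refine Finset.sum_congr rfl fun m hm => ?_
      have hm' : m ≤ N := by simpa [Nat.lt_succ_iff] using hm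
      have e2 : i + j + l - N - i + m = j + l - ((N - m : ℕ) : ℤ) := by omega
      rw [e2, coeff_single_mul_single, RingDer.iter_zsmul, mul_smul_comm, smul_smul]
    · intro m hm
      simp only [Finset.coe_range, Set.mem_Iio]
      by_contra h
      refine hm ?_
      dsimp only
      rw [coeff_single_mul_single_of_lt j l b c (i + j + l - N - i + m) (by omega)]
      simp
  rw [hL, hR]
  have h1 : ∀ p ∈ Finset.HasAntidiagonal.antidiagonal N,
      (Ring.choose i p.1 * Ring.choose j p.2) • (a * d^[p.1] (b * d^[p.2] c)) =
      ∑ s ∈ Finset.HasAntidiagonal.antidiagonal p.1,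
        (Ring.choose i (s.1 + s.2) * Ring.choose j p.2 * ((s.1 + s.2).choose s.1 : ℤ)) •
          (a * (d^[s.1] b * d^[s.2 + p.2] c)) := by
    intro p _
    rw [RingDer.iter_leibniz, Finset.mul_sum, Finset.smul_sum]
    refine Finset.sum_congr rfl fun s hs => ?_
    rw [Finset.HasAntidiagonal.mem_antidiagonal] at hs
    rw [hs, mul_smul_comm, ← Function.iterate_add_apply, ← natCast_zsmul, smul_smul]
  rw [Finset.sum_congr rfl h1, Finset.sum_sigma']
  have h2 : ∀ p ∈ Finset.HasAntidiagonal.antidiagonal N,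
      (Ring.choose i p.1 * Ring.choose (i + j - p.1) p.2) • (a * (d^[p.1] b * d^[p.2] c)) =
      ∑ s ∈ Finset.HasAntidiagonal.antidiagonal p.2,
        (Ring.choose i (p.1 + s.1) * Ring.choose j s.2 * ((p.1 + s.1).choose p.1 : ℤ)) •
          (a * (d^[p.1] b * d^[s.1 + s.2] c)) := by
    intro p _
    rw [← choose_identity, Finset.sum_smul]
    refine Finset.sum_congr rfl fun s hs => ?_
    rw [Finset.HasAntidiagonal.mem_antidiagonal] at hs
    rw [hs]
  rw [Finset.sum_congr rfl h2, Finset.sum_sigma']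
  refine Finset.sum_nbij' (fun x => ⟨(x.1.1 + x.2.1, x.2.2), (x.1.1, x.2.1)⟩)
    (fun x => ⟨(x.2.1, x.2.2 + x.1.2), (x.2.2, x.1.2)⟩) ?_ ?_ ?_ ?_ ?_
  · rintro ⟨⟨p, q⟩, ⟨s, t⟩⟩
    simp only [Finset.mem_sigma, Finset.HasAntidiagonal.mem_antidiagonal]
    rintro ⟨rfl, rfl⟩
    simp [add_assoc]
  · rintro ⟨⟨p, q⟩, ⟨s, t⟩⟩
    simp only [Finset.mem_sigma, Finset.HasAntidiagonal.mem_antidiagonal]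
    rintro ⟨rfl, rfl⟩
    simp [add_assoc]
  · rintro ⟨⟨p, q⟩, ⟨s, t⟩⟩
    simp only [Finset.mem_sigma, Finset.HasAntidiagonal.mem_antidiagonal]
    rintro ⟨h, rfl⟩
    rfl
  · rintro ⟨⟨p, q⟩, ⟨s, t⟩⟩
    simp only [Finset.mem_sigma, Finset.HasAntidiagonal.mem_antidiagonal]
    rintro ⟨h, rfl⟩
    rfl
  · rintro ⟨⟨p, q⟩, ⟨s, t⟩⟩ _
    rfl

theorem eq_zero_of_single (F : PsDO d → A) (hadd : ∀ x y, F (x + y) = F x + F y)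
    (hs : ∀ i a, F (single i a) = 0)
    (hK : ∃ K : ℤ, ∀ f : PsDO d, (∀ i, K < i → f.coeff i = 0) → F f = 0) (f : PsDO d) :
    F f = 0 := by
  obtain ⟨K, hK⟩ := hK
  obtain ⟨N, hN⟩ := f.bdd
  let G : PsDO d →+ A := AddMonoidHom.mk' F hadd
  have hsum : ∀ (s : Finset ℤ) (n : ℤ),
      (∑ i ∈ s, single i (f.coeff i) : PsDO d).coeff n = if n ∈ s then f.coeff n else 0 := by
    intro s n
    induction s using Finset.induction_on with
    | empty => simp
    | insert i s hi ih =>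
      rw [Finset.sum_insert hi, coeff_add, ih, coeff_single]
      by_cases h : n = i
      · subst h; simp [hi]
      · simp [h]
  have hsplit : f = (∑ i ∈ Finset.Ioc K N, single i (f.coeff i)) +
      (f - ∑ i ∈ Finset.Ioc K N, single i (f.coeff i)) := by abel
  have h1 : G (∑ i ∈ Finset.Ioc K N, single i (f.coeff i)) = 0 := by
    rw [map_sum]
    exact Finset.sum_eq_zero fun i _ => hs i _
  have h2 : F (f - ∑ i ∈ Finset.Ioc K N, single i (f.coeff i)) = 0 := by
    refine hK _ fun i hi => ?_
    rw [coeff_sub, hsum]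
    by_cases h : i ≤ N
    · simp [hi, h]
    · simp [h, hN i (not_le.mp h)]
  rw [hsplit, hadd, h2, add_zero]
  exact h1

protected theorem mul_assoc (f g h : PsDO d) : f * g * h = f * (g * h) := by
  have key : ∀ (n : ℤ) (f g h : PsDO d), (f * g * h - f * (g * h)).coeff n = 0 := by
    intro n f g h
    have hord : ∀ (f g h : PsDO d) (N M K : ℤ), (∀ i, N < i → f.coeff i = 0) →
        (∀ i, M < i → g.coeff i = 0) → (∀ i, K < i → h.coeff i = 0) → N + M + K < n →
        (f * g * h - f * (g * h)).coeff n = 0 := by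
      intro f g h N M K hN hM hK hn
      rw [coeff_sub, coeff_mul_of_lt (N := N + M) (M := K) (fun _ => coeff_mul_of_lt hN hM) hK hn,
        coeff_mul_of_lt (N := N) (M := M + K) hN (fun _ => coeff_mul_of_lt hM hK) (by omega),
        sub_zero]
    have hsingle : ∀ (i : ℤ) (a : A) (j : ℤ), i < j → (single i a : PsDO d).coeff j = 0 :=
      fun i a j hj => by simp [coeff_single, hj.ne']
    refine eq_zero_of_single (fun f => (f * g * h - f * (g * h)).coeff n) ?_ ?_ ?_ f
    · intro x y
      rw [← coeff_add, PsDO.right_distrib, PsDO.right_distrib, PsDO.right_distrib]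
      congr 1; abel
    rotate_left
    · obtain ⟨M, hM⟩ := g.bdd
      obtain ⟨K, hK⟩ := h.bdd
      exact ⟨n - M - K - 1, fun f hf => hord f g h _ M K hf hM hK (by omega)⟩
    intro i a
    refine eq_zero_of_single (fun g => (single i a * g * h - single i a * (g * h)).coeff n)
      ?_ ?_ ?_ g
    · intro x y
      rw [← coeff_add, PsDO.left_distrib, PsDO.right_distrib, PsDO.right_distrib,
        PsDO.left_distrib]
      congr 1; abel
    rotate_left
    · obtain ⟨K, hK⟩ := h.bdd
      exact ⟨n - i - K - 1, fun g hg => hord _ g h i _ K (hsingle i a) hg hK (by omega)⟩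
    intro j b
    refine eq_zero_of_single
      (fun h => (single i a * single j b * h - single i a * (single j b * h)).coeff n) ?_ ?_ ?_ h
    · intro x y
      rw [← coeff_add, PsDO.left_distrib, PsDO.left_distrib, PsDO.left_distrib]
      congr 1; abel
    · intro l c
      rw [assoc_single, sub_self, coeff_zero]
    · exact ⟨n - i - j - 1, fun h hh => hord _ _ h i j _ (hsingle i a) (hsingle j b) hh (by omega)⟩
  ext n
  have := key n f g h
  rw [coeff_sub] at this
  exact sub_eq_zero.mp this

theorem one_def : (1 : PsDO d) = single 0 1 := rfl

protected theorem one_mul (f : PsDO d) : 1 * f = f := by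
  ext n
  rw [one_def, coeff_single_mul, finsum_eq_single _ 0]
  · simp
  · intro k hk
    rw [Ring.choose_zero_pos ℤ (Nat.pos_of_ne_zero hk), zero_smul]

protected theorem mul_one (f : PsDO d) : f * 1 = f := by
  ext n
  rw [one_def, coeff_mul_single, finsum_eq_single _ 0]
  · simp
  · intro k hk
    obtain ⟨k, rfl⟩ := Nat.exists_eq_succ_of_ne_zero hk
    rw [Function.iterate_succ_apply, d.map_one, d.iter_zero, mul_zero, smul_zero]

noncomputable instance : Ring (PsDO d) :=
  { (inferInstance : AddCommGroup (PsDO d)) with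
    mul := (· * ·)
    one := 1
    left_distrib := PsDO.left_distrib
    right_distrib := PsDO.right_distrib
    mul_assoc := PsDO.mul_assoc
    one_mul := PsDO.one_mul
    mul_one := PsDO.mul_one
    zero_mul := fun f => by
      have h := PsDO.right_distrib 0 0 f
      rw [add_zero] at h
      exact left_eq_add.mp h
    mul_zero := fun f => by
      have h := PsDO.left_distrib f 0 0
      rw [add_zero] at h
      exact left_eq_add.mp h }

/-- A derivation `e` of `A` that commutes with `d` acts on `A((∂⁻¹))` coefficientwise. -/
noncomputable def extendDer (e : RingDer A) (h : ∀ a, e (d a) = d (e a)) : RingDer (PsDO d) where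
  toFun f := ofCoeff (fun i => e (f.coeff i)) (by
    obtain ⟨N, hN⟩ := f.bdd
    exact ⟨N, fun i hi => by simp only [hN i hi, map_zero]⟩)
  map_zero' := PsDO.ext fun i => map_zero e
  map_add' f g := PsDO.ext fun i => map_add e _ _
  leibniz' f g := PsDO.ext fun n => by
    have hc : ∀ k a, e (d^[k] a) = d^[k] (e a) := fun k a =>
      Function.Commute.iterate_right (f := e) (g := d) h k a
    rw [coeff_add, coeff_mul, coeff_mul, ← finsum_add_distrib (mul_support _ _ n)
      (mul_support _ _ n)]
    simp only [coeff_ofCoeff]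
    rw [coeff_mul]
    change e.toAddMonoidHom _ = _
    rw [AddMonoidHom.map_finsum _ (mul_support f g n)]
    refine finsum_congr fun p => ?_
    change e _ = _
    rw [map_zsmul, e.leibniz, smul_add, hc]

theorem coeff_extendDer (e : RingDer A) (h : ∀ a, e (d a) = d (e a)) (f : PsDO d) (i : ℤ) :
    (extendDer e h f).coeff i = e (f.coeff i) := rfl

end PsDO

/-- A ring with a family of pairwise commuting derivations. -/
structure DiffRing (ι : Type v) where
  /-- the underlying ring -/
  carrier : Type u
  [ring : Ring carrier]
  /-- the derivations -/
  der : ι → RingDer carrier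
  comm : ∀ i j a, der i (der j a) = der j (der i a)

attribute [instance] DiffRing.ring

namespace DiffRing

/-- `R((∂ᵢ⁻¹))`, with all the derivations of `R` extended coefficientwise. -/
noncomputable def psdo {ι : Type v} (R : DiffRing.{u} ι) (i : ι) : DiffRing.{u} ι where
  carrier := PsDO (R.der i)
  der j := PsDO.extendDer (R.der j) (R.comm j i)
  comm j l a := PsDO.ext fun m => R.comm j l (a.coeff m)

/-- The iterated ring `R((∂₁⁻¹))…((∂ⱼ⁻¹))`; the index `i : Fin n` stands for the variable number
`i + 1`. -/
noncomputable def iter {n : ℕ} (R : DiffRing.{u} (Fin n)) : (j : ℕ) → j ≤ n → DiffRing.{u} (Fin n)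
  | 0, _ => R
  | j + 1, h => (iter R j (Nat.le_of_succ_le h)).psdo ⟨j, h⟩

/-- The coefficient of `∂₁ ^ α₁ ⋯ ∂ⱼ ^ αⱼ` of an element of `R((∂₁⁻¹))…((∂ⱼ⁻¹))`. -/
noncomputable def coeff {n : ℕ} (R : DiffRing.{u} (Fin n)) :
    (j : ℕ) → (h : j ≤ n) → (R.iter j h).carrier → (Fin j → ℤ) → R.carrier
  | 0, _, X, _ => X
  | j + 1, h, X, α => coeff R j (Nat.le_of_succ_le h)
      (PsDO.coeff (d := (R.iter j (Nat.le_of_succ_le h)).der ⟨j, h⟩) X (α (Fin.last j)))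
      (fun i => α i.castSucc)

/-- The operator `a ∂₁ ^ α₁ ⋯ ∂ⱼ ^ αⱼ` as an element of `R((∂₁⁻¹))…((∂ⱼ⁻¹))`. -/
noncomputable def monomial {n : ℕ} (R : DiffRing.{u} (Fin n)) :
    (j : ℕ) → (h : j ≤ n) → (Fin j → ℤ) → R.carrier → (R.iter j h).carrier
  | 0, _, _, a => a
  | j + 1, h, α, a => PsDO.single (d := (R.iter j (Nat.le_of_succ_le h)).der ⟨j, h⟩)
      (α (Fin.last j)) (monomial R j (Nat.le_of_succ_le h) (fun i => α i.castSucc) a)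

/-- The ring `k[[x₁, …, xₙ]]` with the derivations `∂/∂xᵢ`. -/
noncomputable def powerSeries (k : Type u) [Field k] (n : ℕ) : DiffRing.{u} (Fin n) where
  carrier := MvPowerSeries (Fin n) k
  der i :=
    { (MvPowerSeries.pderiv k i).toLinearMap.toAddMonoidHom with
      leibniz' := fun a b => by
        change MvPowerSeries.pderiv k i (a * b) =
          MvPowerSeries.pderiv k i a * b + a * MvPowerSeries.pderiv k i b
        rw [Derivation.leibniz, smul_eq_mul, smul_eq_mul]
        ring }
  comm i j a := by
    change MvPowerSeries.pderiv k i (MvPowerSeries.pderiv k j a) =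
      MvPowerSeries.pderiv k j (MvPowerSeries.pderiv k i a)
    ext m
    by_cases h : i = j
    · rw [h]
    · have h' : j ≠ i := fun e => h e.symm
      simp [MvPowerSeries.coeff_pderiv, h, h', add_right_comm, mul_right_comm]

end DiffRing

namespace PseudoDiff

/-- The ring `E = k[[x₁, …, xₙ]]((∂₁⁻¹))…((∂ₙ⁻¹))`. -/
def E (k : Type u) [Field k] (n : ℕ) : Type u :=
  ((DiffRing.powerSeries k n).iter n le_rfl).carrier

noncomputable instance (k : Type u) [Field k] (n : ℕ) : Ring (E k n) :=
  ((DiffRing.powerSeries k n).iter n le_rfl).ring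

variable {k : Type u} [Field k] {n : ℕ}

/-- The coefficient in `k[[x₁, …, xₙ]]` of `∂₁ ^ α₁ ⋯ ∂ₙ ^ αₙ`. -/
noncomputable def coeff (X : E k n) (α : Fin n → ℤ) : MvPowerSeries (Fin n) k :=
  (DiffRing.powerSeries k n).coeff n le_rfl X α

/-- The operator `∂ᵢ` in `E`. -/
noncomputable def del (i : Fin n) : E k n :=
  (DiffRing.powerSeries k n).monomial n le_rfl (Pi.single i 1) (1 : MvPowerSeries (Fin n) k)

/-- For `E = E'((∂ₙ⁻¹))` with `n ≥ 1` variables (here `n + 1` of them), the coefficient in `E'` of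
the power `m` of the last derivative. -/
noncomputable def lastCoeff (X : E k (n + 1)) (m : ℤ) :
    ((DiffRing.powerSeries k (n + 1)).iter n (Nat.le_succ n)).carrier :=
  PsDO.coeff (d := ((DiffRing.powerSeries k (n + 1)).iter n (Nat.le_succ n)).der (Fin.last n)) X m

/-- `E₋`: the operators that contain only negative powers of the last derivative. -/
def EMinus (k : Type u) [Field k] (n : ℕ) : Set (E k (n + 1)) :=
  {X | ∀ m : ℤ, 0 ≤ m → lastCoeff X m = 0}

/-- The field `k((z₁))…((zₙ))` of iterated Laurent series, bundled with its field structure. -/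
noncomputable def iterLaurentAux (k : Type u) [Field k] : ℕ → (A : Type u) ×' Field A
  | 0 => ⟨k, inferInstance⟩
  | n + 1 =>
    letI := (iterLaurentAux k n).2
    ⟨LaurentSeries (iterLaurentAux k n).1, inferInstance⟩

/-- The field `k((z₁))…((zₙ))` of iterated Laurent series. -/
def IterLaurent (k : Type u) [Field k] (n : ℕ) : Type u := (iterLaurentAux k n).1

noncomputable instance (k : Type u) [Field k] (n : ℕ) : Field (IterLaurent k n) :=
  (iterLaurentAux k n).2

/-- The coefficient of `z₁ ^ α₁ ⋯ zₙ ^ αₙ` of an iterated Laurent series. -/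
noncomputable def laurentCoeff : (n : ℕ) → IterLaurent k n → (Fin n → ℤ) → k
  | 0, c, _ => c
  | n + 1, c, α =>
    letI := (iterLaurentAux k n).2
    laurentCoeff n (HahnSeries.coeff (Γ := ℤ) (R := IterLaurent k n) c (α (Fin.last n)))
      (fun i => α i.castSucc)

/-- The ordered product `U₁ ^ α₁ ⋯ Uₙ ^ αₙ`. -/
noncomputable def zpowProd (U : Fin n → (E k n)ˣ) (α : Fin n → ℤ) : (E k n)ˣ :=
  (List.ofFn fun i => U i ^ α i).prod

/-- `X = ∑ c_α U₁ ^ (-α₁) ⋯ Uₙ ^ (-αₙ)`, where `c = ∑ c_α z ^ α` is an iterated Laurent series: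
the sum converges coefficientwise, i.e. every coefficient of `X` is the sum of the corresponding
coefficients of the terms, only finitely many of which are nonzero. -/
def IsLaurentSum (U : Fin n → (E k n)ˣ) (c : IterLaurent k n) (X : E k n) : Prop :=
  ∀ β : Fin n → ℤ,
    {α : Fin n → ℤ | laurentCoeff n c α • coeff (zpowProd U (-α) : E k n) β ≠ 0}.Finite ∧
    coeff X β = ∑ᶠ α : Fin n → ℤ, laurentCoeff n c α • coeff (zpowProd U (-α) : E k n) β

/-- The set `k((U₁⁻¹))…((Uₙ⁻¹))` of all operators that are sums of iterated Laurent series in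
`U₁⁻¹, …, Uₙ⁻¹` with coefficients in `k`. -/
def laurentIn (U : Fin n → (E k n)ˣ) : Set (E k n) :=
  {X | ∃ c : IterLaurent k n, IsLaurentSum U c X}

end PseudoDiff

/-! In `E` one has `[∂ᵢ, f] = ∂f/∂xᵢ`. Write `Lᵢ = ∂ᵢ + Tᵢ`; then `[Lᵢ, Lⱼ] = 0` says that the
connection `∂/∂xᵢ + Tᵢ` is flat. An invertible horizontal section, that is `S` with `∂S/∂xᵢ = -Tᵢ
S`, satisfies `Lᵢ S = S ∂ᵢ`. It conjugates all `Lᵢ` to the `∂ᵢ` at once, and everything reduces to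
the `∂ᵢ`.

Such an `S` exists (`PsDO.exists_dressing`) because `Tᵢ` has negative order in the last derivative.
The equation `S = 1 + J(-T S)`, with `J` a Poincaré primitive taken coefficientwise
(`DiffRing.exists_primitive_mvPowerSeries`), is solved by successive approximation
(`PsDO.exists_fixedPoint`), and flatness shows order by order that the family being integrated is
closed. The Poincaré lemma needs characteristic zero.

An operator that commutes with every `∂ᵢ` is killed by every `∂/∂xᵢ`, so, again in characteristic
zero, its coefficients lie in `k` (`DiffRing.mem_range_ofIterLaurent`). These operators are the
image of the field `k((z₁))…((zₙ))` under `zᵢ ↦ ∂ᵢ⁻¹`, hence commute with each other; conjugation by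
`S` carries them onto the centralizer of the `Lᵢ`.

Coefficientwise convergence alone is not stable under multiplication. The stronger notion
`DiffRing.SumsTo`, which bounds the orders uniformly at each stage, is stable
(`DiffRing.isSummation_sumsTo`), so the expansion in the `∂ᵢ⁻¹` survives conjugation by `S`. -/

namespace PsDO

/-! ### Successive approximation with respect to the order. -/

variable {A : Type u} [Ring A] {d : RingDer A}

/-- A map that preserves a bound on the order and brings operators closer together by one order has
a fixed point. -/
theorem exists_fixedPoint (F : PsDO d → PsDO d) (N : ℤ)
    (hN : ∀ X : PsDO d, (∀ m, N < m → X.coeff m = 0) → ∀ m, N < m → (F X).coeff m = 0)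
    (hF : ∀ (X Y : PsDO d) (r : ℤ), (∀ m, r < m → X.coeff m = Y.coeff m) →
      ∀ m, r - 1 < m → (F X).coeff m = (F Y).coeff m) :
    ∃ X : PsDO d, (∀ m, N < m → X.coeff m = 0) ∧ F X = X := by
  have hb : ∀ q : ℕ, ∀ m, N < m → (F^[q] 0).coeff m = 0 := by
    intro q
    induction q with
    | zero => intro m _; rfl
    | succ q ih => rw [Function.iterate_succ_apply']; exact hN _ ih
  have hstep : ∀ q : ℕ, ∀ m, N - q < m → (F^[q] 0).coeff m = (F^[q + 1] 0).coeff m := by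
    intro q
    induction q with
    | zero => intro m hm; rw [hb 0 m (by simpa using hm), hb 1 m (by simpa using hm)]
    | succ q ih =>
      intro m hm
      rw [Function.iterate_succ_apply', Function.iterate_succ_apply' F (q + 1)]
      exact hF _ _ _ ih m (by push_cast at hm; omega)
  have hlim : ∀ q r : ℕ, q ≤ r → ∀ m, N - q < m → (F^[r] 0).coeff m = (F^[q] 0).coeff m := by
    intro q r hqr
    induction r, hqr using Nat.le_induction with
    | base => intro m _; rfl
    | succ r hr ih => intro m hm; rw [← hstep r m (by omega), ih m hm]
  -- From the `q`-th on, the iterates of `0` agree in all orders above `N - q`. The coefficient at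
  -- `m` is read off at the least `q` with `N - q < m`.
  let X : PsDO d := ofCoeff (fun m => (F^[(N - m + 1).toNat] 0).coeff m)
    ⟨N, fun m hm => hb _ m hm⟩
  have hX : ∀ q : ℕ, ∀ m, N - q < m → X.coeff m = (F^[q] 0).coeff m := by
    intro q m hm
    by_cases h : N < m
    · rw [hb q m h]; exact hb _ m h
    · exact (hlim _ _ (by omega) m (by omega)).symm
  refine ⟨X, fun m hm => hb _ m hm, ext fun m => ?_⟩
  rw [hX ((N - m).toNat + 2) m (by push_cast; omega), Function.iterate_succ_apply']
  exact hF _ _ _ (hX ((N - m).toNat + 1)) m (by push_cast; omega)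

/-- Multiplication by an operator of negative order gains one order: the contraction property
required by `exists_fixedPoint`. -/
theorem coeff_mul_congr_right {T : PsDO d} (hT : ∀ m, 0 ≤ m → T.coeff m = 0) {X Y : PsDO d} {r : ℤ}
    (h : ∀ m, r < m → X.coeff m = Y.coeff m) (m : ℤ) (hm : r - 1 < m) :
    (T * X).coeff m = (T * Y).coeff m := by
  rw [← sub_eq_zero, ← coeff_sub, ← mul_sub]
  exact coeff_mul_of_lt (N := -1) (M := r) (fun i hi => hT i (by omega))
    (fun i hi => by rw [coeff_sub, h i hi, sub_self]) (by omega)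

theorem coeff_mul_congr_left {T : PsDO d} (hT : ∀ m, 0 ≤ m → T.coeff m = 0) {X Y : PsDO d} {r : ℤ}
    (h : ∀ m, r < m → X.coeff m = Y.coeff m) (m : ℤ) (hm : r - 1 < m) :
    (X * T).coeff m = (Y * T).coeff m := by
  rw [← sub_eq_zero, ← coeff_sub, ← sub_mul]
  exact coeff_mul_of_lt (N := r) (M := -1) (fun i hi => by rw [coeff_sub, h i hi, sub_self])
    (fun i hi => hT i (by omega)) (by omega)

theorem coeff_one_of_pos {m : ℤ} (hm : 0 < m) : (1 : PsDO d).coeff m = 0 := by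
  rw [one_def, coeff_single, if_neg hm.ne']

/-- The equations `Y = 1 - T Y` and `Z = 1 - Z T` are solved by successive approximation; they yield
a right and a left inverse, which then coincide. -/
theorem isUnit_one_add {T : PsDO d} (hT : ∀ m, 0 ≤ m → T.coeff m = 0) : IsUnit (1 + T) := by
  have hT' : ∀ m, (-1 : ℤ) < m → T.coeff m = 0 := fun m hm => hT m (by omega)
  obtain ⟨Y, -, hY⟩ := exists_fixedPoint (fun Y => 1 - T * Y) 0
    (fun Y hY m hm => by
      rw [coeff_sub, coeff_one_of_pos hm, coeff_mul_of_lt hT' hY (by omega), sub_zero])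
    (fun X Y r h m hm => by rw [coeff_sub, coeff_sub, coeff_mul_congr_right hT h m hm])
  obtain ⟨Z, -, hZ⟩ := exists_fixedPoint (fun Y => 1 - Y * T) 0
    (fun Y hY m hm => by
      rw [coeff_sub, coeff_one_of_pos hm, coeff_mul_of_lt hY hT' (by omega), sub_zero])
    (fun X Y r h m hm => by rw [coeff_sub, coeff_sub, coeff_mul_congr_left hT h m hm])
  have h1 : (1 + T) * Y = 1 := by rw [add_mul, one_mul]; nth_rewrite 1 [← hY]; simp
  have h2 : Z * (1 + T) = 1 := by rw [mul_add, mul_one]; nth_rewrite 1 [← hZ]; simp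
  exact ⟨⟨1 + T, Y, h1, by rwa [← left_inv_eq_right_inv h2 h1]⟩, rfl⟩

end PsDO

/-! ### Primitives and the dressing operator. -/

/-- `J` integrates the closed families: it solves the equations `D i y = b i` whenever the
compatibility conditions `D i (b j) = D j (b i)` hold. -/
structure IsPrimitive {ι : Type v} {A : Type u} [Ring A] (D : ι → RingDer A)
    (J : (ι → A) → A) : Prop where
  zero : J 0 = 0
  der : ∀ b : ι → A, (∀ i j, D i (b j) = D j (b i)) → ∀ i, D i (J b) = b i

namespace PsDO

variable {A : Type u} [Ring A] {ι : Type v}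

theorem exists_bound_of_finite [Finite ι] {d : RingDer A} (b : ι → PsDO d) :
    ∃ N : ℤ, ∀ i m, N < m → (b i).coeff m = 0 := by
  choose N hN using fun i => (b i).bdd
  obtain ⟨M, hM⟩ := (Set.finite_range N).bddAbove
  exact ⟨M, fun i m hm => hN i m (lt_of_le_of_lt (hM ⟨i, rfl⟩) hm)⟩

/-- A primitive acts on operators coefficientwise. -/
noncomputable def primitive [Finite ι] {d : RingDer A} (J : (ι → A) → A) (hJ : J 0 = 0)
    (b : ι → PsDO d) : PsDO d :=
  ofCoeff (fun m => J fun i => (b i).coeff m) (by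
    obtain ⟨N, hN⟩ := exists_bound_of_finite b
    exact ⟨N, fun m hm => by rw [show (fun i => (b i).coeff m) = 0 from funext fun i => hN i m hm,
      hJ]⟩)

variable {D : ι → RingDer A} {l : ι} (hD : ∀ i j a, D i (D j a) = D j (D i a))

/-- Dressing: a flat connection `D i + T i` whose potentials `T i` have negative order has a
horizontal section of the form `1 + negative order`. -/
theorem exists_dressing [Finite ι] {J : (ι → A) → A} (hJ : IsPrimitive D J)
    (T : ι → PsDO (D l)) (hT : ∀ i m, 0 ≤ m → (T i).coeff m = 0)
    (hflat : ∀ i j, extendDer (D i) (hD i l) (T j) + T i * T j =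
      extendDer (D j) (hD j l) (T i) + T j * T i) :
    ∃ S : (PsDO (D l))ˣ, ∀ i, extendDer (D i) (hD i l) S = -(T i * S) := by
  have hT' : ∀ i m, (-1 : ℤ) < m → (T i).coeff m = 0 := fun i m hm => hT i m (by omega)
  -- The fixed point is not yet known to be horizontal, since `J` inverts the derivations only on
  -- closed families.
  obtain ⟨S, hS0, hS⟩ := exists_fixedPoint
    (fun S : PsDO (D l) => 1 + primitive J hJ.zero fun i => -(T i * S)) 0
    (fun S hS m hm => by
      rw [coeff_add, coeff_one_of_pos hm, zero_add, primitive, coeff_ofCoeff,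
        show (fun i => (-(T i * S)).coeff m) = 0 from funext fun i => by
          rw [coeff_neg, coeff_mul_of_lt (hT' i) hS (by omega)]; exact neg_zero, hJ.zero])
    (fun X Y r h m hm => by
      simp only [coeff_add, primitive, coeff_ofCoeff, coeff_neg]
      congr 2
      funext i
      rw [coeff_mul_congr_right (hT i) h m hm])
  have hunit : IsUnit S := by
    rw [← hS]
    refine isUnit_one_add fun m hm => ?_
    rw [primitive, coeff_ofCoeff, show (fun i => (-(T i * S)).coeff m) = 0 from funext fun i => by
          rw [coeff_neg, coeff_mul_of_lt (hT' i) hS0 (by omega)]; exact neg_zero, hJ.zero]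
  have hone : ∀ i m, D i ((1 : PsDO (D l)).coeff m) = 0 := by
    intro i m
    rw [one_def, coeff_single]
    split_ifs
    · exact (D i).map_one
    · exact map_zero _
  have hderS : ∀ i m, (extendDer (D i) (hD i l) S).coeff m =
      D i (J fun i => (-(T i * S)).coeff m) := by
    intro i m
    nth_rewrite 1 [← hS]
    rw [coeff_extendDer, coeff_add, map_add, hone, zero_add]
    rfl
  -- Flatness makes the covariant derivatives commute; here they are applied to `S`, whose defect is
  -- `Rᵢ = Dᵢ S + Tᵢ S`. Nothing about `S` is used.
  have hcurv : ∀ i j, extendDer (D i) (hD i l) (extendDer (D j) (hD j l) S + T j * S) +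
      T i * (extendDer (D j) (hD j l) S + T j * S) =
      extendDer (D j) (hD j l) (extendDer (D i) (hD i l) S + T i * S) +
      T j * (extendDer (D i) (hD i l) S + T i * S) := by
    intro i j
    have e : extendDer (D i) (hD i l) (extendDer (D j) (hD j l) S) =
        extendDer (D j) (hD j l) (extendDer (D i) (hD i l) S) := ext fun m => hD i j _
    have := congrArg (· * S) (hflat i j)
    simp only [add_mul] at this
    rw [map_add, map_add, e, RingDer.leibniz, RingDer.leibniz, mul_add, mul_add, ← mul_assoc,
      ← mul_assoc]
    calc _ = extendDer (D j) (hD j l) (extendDer (D i) (hD i l) S) +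
        (extendDer (D i) (hD i l) (T j) * S + T i * T j * S) +
          T j * extendDer (D i) (hD i l) S + T i * extendDer (D j) (hD j l) S := by abel
      _ = _ := by rw [this]; abel
  -- The defect vanishes order by order. If all `Rⱼ` vanish in orders above `-q`, then `Tᵢ Rⱼ`
  -- vanishes in order `-q` too, and `hcurv` reads `Dᵢ Rⱼ = Dⱼ Rᵢ` there. The second derivatives of
  -- `S` cancel, so the family `-Tᵢ S` is closed in this order and `J` does integrate it.
  have key : ∀ q : ℕ, ∀ i m, -(q : ℤ) < m →
      (extendDer (D i) (hD i l) S + T i * S).coeff m = 0 := by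
    intro q
    induction q with
    | zero =>
      intro i m hm
      have h0 : ∀ j, (T j * S).coeff m = 0 := fun j => coeff_mul_of_lt (hT' j) hS0 (by simp at hm; omega)
      rw [coeff_add, hderS, h0, add_zero, show (fun i => (-(T i * S)).coeff m) = 0 from
        funext fun j => by rw [coeff_neg, h0]; exact neg_zero, hJ.zero, map_zero]
    | succ q ih =>
      intro i m hm
      rw [coeff_add, hderS, hJ.der]
      · rw [coeff_neg, neg_add_cancel]
      intro i j
      have h := congrArg (fun X => X.coeff m) (hcurv i j)
      simp only [coeff_add, coeff_extendDer] at h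
      rw [coeff_mul_of_lt (hT' i) (ih j) (by push_cast at hm; omega),
        coeff_mul_of_lt (hT' j) (ih i) (by push_cast at hm; omega), add_zero, add_zero, map_add,
        map_add, hD i j] at h
      rw [coeff_neg, coeff_neg, map_neg, map_neg, add_left_cancel h]
  refine ⟨hunit.unit, fun i => ext fun m => ?_⟩
  have := key ((-m).toNat + 1) i m (by push_cast; omega)
  rw [coeff_add] at this
  rw [coeff_neg]
  exact eq_neg_of_add_eq_zero_left this

/-- The extended derivations act on each coefficient separately, so closedness and integration never
mix orders. This carries the Poincaré lemma through every adjunction of a `∂`. -/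
theorem isPrimitive_primitive [Finite ι] {J : (ι → A) → A} (hJ : IsPrimitive D J) :
    IsPrimitive (fun i => extendDer (d := D l) (D i) (hD i l)) (primitive J hJ.zero) where
  zero := ext fun _ => hJ.zero
  der b hb i := ext fun m =>
    hJ.der (fun i => (b i).coeff m) (fun i j => congrArg (fun X => X.coeff m) (hb i j)) i

end PsDO

/-! ### The Poincaré lemma for power series and for the iterated rings. -/

namespace DiffRing

/-- The Poincaré lemma for formal power series in characteristic zero. -/
theorem exists_primitive_mvPowerSeries (k : Type u) [Field k] [CharZero k] (σ : Type*) :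
    ∃ J : (σ → MvPowerSeries σ k) → MvPowerSeries σ k, J 0 = 0 ∧
      ∀ b : σ → MvPowerSeries σ k,
        (∀ i j, MvPowerSeries.pderiv k i (b j) = MvPowerSeries.pderiv k j (b i)) →
        ∀ i, MvPowerSeries.pderiv k i (J b) = b i := by
  classical
  -- The coefficient at `m` is recovered from a single equation, `∂ᵢ y = bᵢ` for some `i` with `m i
  -- ≠ 0`, by dividing by `m i`. The constant term is free and set to `0`, so that `J 0 = 0`.
  let J : (σ → MvPowerSeries σ k) → MvPowerSeries σ k := fun b m =>
    if h : ∃ i, m i ≠ 0 then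
      MvPowerSeries.coeff (m - Finsupp.single h.choose 1) (b h.choose) / (m h.choose : k) else 0
  refine ⟨J, ?_, fun b hb i => ?_⟩
  · funext m
    by_cases h : ∃ i, m i ≠ 0
    · refine (dif_pos h).trans ?_
      change (0 : k) / _ = 0
      exact zero_div _
    · exact dif_neg h
  · ext m
    rw [MvPowerSeries.coeff_pderiv]
    have h : ∃ j, (m + Finsupp.single i 1 : σ →₀ ℕ) j ≠ 0 := ⟨i, by simp⟩
    have hJ : MvPowerSeries.coeff (m + Finsupp.single i 1) (J b) =
      MvPowerSeries.coeff (m + Finsupp.single i 1 - Finsupp.single h.choose 1) (b h.choose) /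
        (((m + Finsupp.single i 1 : σ →₀ ℕ) h.choose : ℕ) : k) := dif_pos h
    rw [hJ]
    have hne := h.choose_spec
    -- Which index was chosen does not matter: for `j ≠ i` the compatibility condition, read at `m -
    -- eⱼ`, turns the equation for `bⱼ` into the one for `bᵢ`.
    generalize h.choose = j at hne
    have hne' : (((m + Finsupp.single i 1 : σ →₀ ℕ) j : ℕ) : k) ≠ 0 := Nat.cast_ne_zero.mpr hne
    rw [div_mul_eq_mul_div, div_eq_iff hne']
    by_cases hij : j = i
    · subst hij
      simp
    · have hmj : m j ≠ 0 := by simpa [Finsupp.single_apply, Ne.symm hij] using hne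
      obtain ⟨p, rfl⟩ : ∃ p, m = p + Finsupp.single j 1 :=
        ⟨m - Finsupp.single j 1, (tsub_add_cancel_of_le (by
          simpa [Finsupp.single_le_iff] using Nat.one_le_iff_ne_zero.mpr hmj)).symm⟩
      have := congrArg (MvPowerSeries.coeff p) (hb i j)
      rw [MvPowerSeries.coeff_pderiv, MvPowerSeries.coeff_pderiv] at this
      rw [add_right_comm, add_tsub_cancel_right]
      simpa [Finsupp.single_apply, hij, Ne.symm hij] using this

theorem exists_isPrimitive_powerSeries (k : Type u) [Field k] [CharZero k] (n : ℕ) :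
    ∃ J, IsPrimitive (powerSeries k n).der J := by
  obtain ⟨J, h0, hJ⟩ := exists_primitive_mvPowerSeries k (Fin n)
  exact ⟨J, h0, hJ⟩

theorem exists_isPrimitive_psdo {ι : Type v} [Finite ι] (R : DiffRing.{u} ι)
    (hR : ∃ J, IsPrimitive R.der J) (l : ι) : ∃ J, IsPrimitive (R.psdo l).der J := by
  obtain ⟨J, hJ⟩ := hR
  exact ⟨_, PsDO.isPrimitive_primitive (l := l) R.comm hJ⟩

theorem exists_isPrimitive_iter {n : ℕ} (R : DiffRing.{u} (Fin n)) (hR : ∃ J, IsPrimitive R.der J)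
    (j : ℕ) (h : j ≤ n) : ∃ J, IsPrimitive (R.iter j h).der J := by
  induction j with
  | zero => exact hR
  | succ j ih => exact exists_isPrimitive_psdo _ (ih (Nat.le_of_succ_le h)) ⟨j, h⟩

end DiffRing

/-! ### Operators with constant coefficients as Laurent series. -/

namespace PsDO

variable {A : Type u} [Ring A] {d : RingDer A}

theorem coeff_single_zero_mul (a : A) (f : PsDO d) (m : ℤ) :
    (single 0 a * f).coeff m = a * f.coeff m := by
  rw [coeff_single_mul, finsum_eq_single _ 0]
  · simp
  · intro q hq
    rw [Ring.choose_zero_pos ℤ (Nat.pos_of_ne_zero hq), zero_smul]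

/-- Constants commute with `∂`: only the terms without derivatives survive, leaving the Cauchy
product that Laurent series have. -/
theorem coeff_mul_of_der_eq_zero (f g : PsDO d) (hg : ∀ m, d (g.coeff m) = 0) (m : ℤ) :
    (f * g).coeff m = ∑ᶠ i : ℤ, f.coeff i * g.coeff (m - i) := by
  rw [coeff_mul, finsum_eq_comp _ (fun i : ℤ => ((i, 0) : ℤ × ℕ)) fun _ _ h => (Prod.mk.inj h).1]
  · simp
  · rintro ⟨i, q⟩ h
    obtain ⟨q, rfl⟩ := Nat.exists_eq_succ_of_ne_zero (n := q) (by rintro rfl; exact h ⟨i, rfl⟩)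
    rw [Function.iterate_succ_apply, hg, d.iter_zero, mul_zero, smul_zero]

theorem coeff_mul_single_zero (a : A) (ha : d a = 0) (f : PsDO d) (m : ℤ) :
    (f * single 0 a).coeff m = f.coeff m * a := by
  rw [coeff_mul_single, finsum_eq_single _ 0]
  · simp
  · intro q hq
    obtain ⟨q, rfl⟩ := Nat.exists_eq_succ_of_ne_zero hq
    rw [Function.iterate_succ_apply, ha, d.iter_zero, mul_zero, smul_zero]

theorem single_one_mul_sub (f : PsDO d) (m : ℤ) :
    (single 1 1 * f - f * single 1 1).coeff m = d (f.coeff m) := by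
  have h1 : (f * single 1 1).coeff m = f.coeff (m - 1) := by
    rw [coeff_mul_single, finsum_eq_single _ 0]
    · simp
    · intro q hq
      obtain ⟨q, rfl⟩ := Nat.exists_eq_succ_of_ne_zero hq
      rw [Function.iterate_succ_apply, d.map_one, d.iter_zero, mul_zero, smul_zero]
  have h2 : (single 1 1 * f).coeff m = f.coeff (m - 1) + d (f.coeff m) := by
    rw [coeff_single_mul, finsum_eq_sum_of_support_subset (s := Finset.range 2)]
    · simp [Finset.sum_range_succ]
    · intro q hq
      simp only [Finset.coe_range, Set.mem_Iio]
      by_contra h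
      have h0 : Ring.choose (1 : ℤ) q = 0 := by
        have := Ring.choose_natCast (R := ℤ) 1 q
        rw [Nat.choose_eq_zero_of_lt (by omega)] at this
        simpa using this
      exact hq (by simp only [h0, zero_smul])
  rw [coeff_sub, h1, h2, add_sub_cancel_left]

/-- The embedding of Laurent series, `z ↦ ∂⁻¹`, for constant coefficients. -/
noncomputable def ofLaurent {K : Type u} [Field K] (ψ : K →+* A) (hψ : ∀ c, d (ψ c) = 0) :
    LaurentSeries K →+* PsDO d where
  toFun c := ofCoeff (fun m => ψ (HahnSeries.coeff c (-m))) ⟨-c.order, fun m hm => by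
    rw [HahnSeries.coeff_eq_zero_of_lt_order (by omega), map_zero]⟩
  map_zero' := ext fun m => by simp
  map_add' c e := ext fun m => by simp
  map_one' := ext fun m => by
    rw [coeff_ofCoeff, one_def, coeff_single, HahnSeries.coeff_one]
    simp only [neg_eq_zero]
    split_ifs <;> simp
  map_mul' c e := ext fun m => by
    classical
    rw [coeff_mul_of_der_eq_zero _ _ fun m => hψ _]
    simp only [coeff_ofCoeff]
    rw [HahnSeries.coeff_mul, map_sum,
      finsum_eq_sum_of_support_subset (s := (Finset.antidiagonal c.isPWO_support
        e.isPWO_support (-m)).image fun p => -p.1)]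
    · rw [Finset.sum_image]
      · refine Finset.sum_congr rfl fun p hp => ?_
        rw [Finset.mem_antidiagonal] at hp
        rw [map_mul, neg_neg, show -(m - -p.1) = p.2 by omega]
      · intro p hp q hq h
        simp only [Finset.mem_coe, Finset.mem_antidiagonal] at hp hq
        have h1 : p.1 = q.1 := neg_injective h
        exact Prod.ext h1 (by omega)
    · intro i hi
      rw [Finset.coe_image]
      refine ⟨(-i, -(m - i)), ?_, by simp⟩
      rw [Finset.mem_coe, Finset.mem_antidiagonal]
      refine ⟨fun h => hi ?_, fun h => hi ?_, show -i + -(m - i) = -m by ring⟩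
      · simp only [h, map_zero, zero_mul]
      · simp only [h, map_zero, mul_zero]

theorem coeff_ofLaurent {K : Type u} [Field K] (ψ : K →+* A) (hψ : ∀ c, d (ψ c) = 0)
    (c : LaurentSeries K) (m : ℤ) :
    (ofLaurent (d := d) ψ hψ c).coeff m = ψ (HahnSeries.coeff c (-m)) := rfl

theorem ofLaurent_single {K : Type u} [Field K] (ψ : K →+* A) (hψ : ∀ c, d (ψ c) = 0) (i : ℤ)
    (a : K) : ofLaurent (d := d) ψ hψ (HahnSeries.single i a) = single (-i) (ψ a) := ext fun m => by
  classical
  rw [coeff_ofLaurent, coeff_single, HahnSeries.coeff_single]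
  by_cases h : m = -i
  · rw [if_pos h, if_pos (by omega)]
  · rw [if_neg h, if_neg (by omega), map_zero]

theorem mem_range_ofLaurent {K : Type u} [Field K] (ψ : K →+* A) (hψ : ∀ c, d (ψ c) = 0)
    (f : PsDO d) (hf : ∀ m, f.coeff m ∈ Set.range ψ) : f ∈ Set.range (ofLaurent (d := d) ψ hψ) := by
  classical
  choose c hc using hf
  obtain ⟨N, hN⟩ := f.bdd
  -- If `A` is the zero ring, `ψ` is not injective and the chosen preimage of `0` may be nonzero.
  -- Replacing it by `0` keeps the support bounded below.
  have hb : BddBelow (Function.support fun i => if f.coeff (-i) = 0 then 0 else c (-i)) := by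
    refine ⟨-N, fun i hi => ?_⟩
    by_contra h
    have h0 : f.coeff (-i) = 0 := hN _ (by omega)
    exact hi (by simp only [h0, if_true])
  refine ⟨HahnSeries.ofSuppBddBelow _ hb, ext fun m => ?_⟩
  rw [coeff_ofLaurent, HahnSeries.coeff_ofSuppBddBelow]
  rw [neg_neg]
  split_ifs with h
  · rw [h, map_zero]
  · exact hc m

end PsDO

/-! ### Summable families. -/

/-- `P F X` is a notion of "the family `F` sums to `X`" that is compatible with the ring operations
and with the derivations `D i`. -/
structure IsSummation {ι : Type v} {A : Type u} [Ring A] (D : ι → RingDer A) {I : Type*}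
    (P : (I → A) → A → Prop) : Prop where
  zero : P 0 0
  add : ∀ {F G X Y}, P F X → P G Y → P (F + G) (X + Y)
  mul_left : ∀ (a) {F X}, P F X → P (fun s => a * F s) (a * X)
  mul_right : ∀ (a) {F X}, P F X → P (fun s => F s * a) (X * a)
  der : ∀ (i) {F X}, P F X → P (fun s => D i (F s)) (D i X)

namespace IsSummation

variable {ι : Type v} {A : Type u} [Ring A] {D : ι → RingDer A} {I : Type*}
  {P : (I → A) → A → Prop}

theorem sum (hP : IsSummation D P) {κ : Type*} (s : Finset κ) {F : κ → I → A} {X : κ → A}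
    (h : ∀ q ∈ s, P (F q) (X q)) : P (fun a => ∑ q ∈ s, F q a) (∑ q ∈ s, X q) := by
  classical
  induction s using Finset.induction_on with
  | empty => exact hP.zero
  | insert q s hq ih =>
    simp only [Finset.sum_insert hq]
    exact hP.add (h q (by simp)) (ih fun r hr => h r (by simp [hr]))

theorem zsmul (hP : IsSummation D P) (m : ℤ) {F : I → A} {X : A} (h : P F X) :
    P (fun a => m • F a) (m • X) := by
  simpa only [zsmul_eq_mul] using hP.mul_left (m : A) h

theorem iter (hP : IsSummation D P) (i : ι) (q : ℕ) {F : I → A} {X : A} (h : P F X) :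
    P (fun a => (D i)^[q] (F a)) ((D i)^[q] X) := by
  induction q with
  | zero => exact h
  | succ q ih => simpa only [Function.iterate_succ_apply'] using hP.der i ih

end IsSummation

namespace PsDO

variable {A : Type u} [Ring A] {ι : Type v} {I : Type*}

/-- Coefficientwise summation of families of uniformly bounded order. -/
def SumsTo {d : RingDer A} (P : (I → A) → A → Prop) (F : I → PsDO d) (X : PsDO d) : Prop :=
  (∃ N : ℤ, ∀ m, N < m → (∀ s, (F s).coeff m = 0) ∧ X.coeff m = 0) ∧
    ∀ m, P (fun s => (F s).coeff m) (X.coeff m)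

/-- The finite index set depends only on the bounds `N` and `M`, so it serves all members of a
uniformly bounded family simultaneously. -/
theorem coeff_mul_eq_sum {d : RingDer A} {f g : PsDO d} {N M : ℤ}
    (hN : ∀ i, N < i → f.coeff i = 0) (hM : ∀ i, M < i → g.coeff i = 0) (m : ℤ) :
    (f * g).coeff m = ∑ p ∈ (Finset.Icc (m - M) N) ×ˢ (Finset.range (M - m + N + 1).toNat),
      Ring.choose p.1 p.2 • (f.coeff p.1 * d^[p.2] (g.coeff (m - p.1 + p.2))) := by
  rw [coeff_mul]
  refine finsum_eq_sum_of_support_subset _ fun p hp => ?_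
  have h1 : p.1 ≤ N := by
    by_contra h
    exact hp (by simp [hN p.1 (not_le.mp h)])
  have h2 : m - p.1 + p.2 ≤ M := by
    by_contra h
    exact hp (by simp [hM _ (not_le.mp h)])
  simp only [Finset.coe_product, Set.mem_prod, Finset.coe_Icc, Set.mem_Icc, Finset.coe_range,
    Set.mem_Iio]
  omega

/-- Under uniform order bounds, a coefficient of a product is a finite sum, over one index set for
the whole family, of expressions built by derivation, multiplication by a fixed element and integer
multiples. `P` respects each of these. -/
theorem isSummation_sumsTo {D : ι → RingDer A} {l : ι} (hD : ∀ i j a, D i (D j a) = D j (D i a))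
    {P : (I → A) → A → Prop} (hP : IsSummation D P) :
    IsSummation (fun i => extendDer (d := D l) (D i) (hD i l)) (SumsTo P) where
  zero := ⟨⟨0, fun _ _ => ⟨fun _ => rfl, rfl⟩⟩, fun _ => hP.zero⟩
  add := by
    rintro F G X Y ⟨⟨N, hN⟩, hF⟩ ⟨⟨M, hM⟩, hG⟩
    refine ⟨⟨max N M, fun m hm => ?_⟩, fun m => hP.add (hF m) (hG m)⟩
    have h1 := hN m (lt_of_le_of_lt (le_max_left _ _) hm)
    have h2 := hM m (lt_of_le_of_lt (le_max_right _ _) hm)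
    exact ⟨fun s => by simp [h1.1 s, h2.1 s], by simp [h1.2, h2.2]⟩
  mul_left := by
    rintro f F X ⟨⟨M, hM⟩, hF⟩
    obtain ⟨N, hN⟩ := f.bdd
    have hF0 : ∀ s m, M < m → (F s).coeff m = 0 := fun s m hm => (hM m hm).1 s
    have hX0 : ∀ m, M < m → X.coeff m = 0 := fun m hm => (hM m hm).2
    refine ⟨⟨N + M, fun m hm => ⟨fun s => coeff_mul_of_lt hN (hF0 s) hm,
      coeff_mul_of_lt hN hX0 hm⟩⟩, fun m => ?_⟩
    simp only [fun s => coeff_mul_eq_sum hN (hF0 s) m, coeff_mul_eq_sum hN hX0 m]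
    exact hP.sum _ fun p _ => hP.zsmul _ (hP.mul_left _ (hP.iter l _ (hF _)))
  mul_right := by
    rintro f F X ⟨⟨M, hM⟩, hF⟩
    obtain ⟨N, hN⟩ := f.bdd
    have hF0 : ∀ s m, M < m → (F s).coeff m = 0 := fun s m hm => (hM m hm).1 s
    have hX0 : ∀ m, M < m → X.coeff m = 0 := fun m hm => (hM m hm).2
    refine ⟨⟨M + N, fun m hm => ⟨fun s => coeff_mul_of_lt (hF0 s) hN hm,
      coeff_mul_of_lt hX0 hN hm⟩⟩, fun m => ?_⟩
    simp only [fun s => coeff_mul_eq_sum (hF0 s) hN m, coeff_mul_eq_sum hX0 hN m]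
    exact hP.sum _ fun p _ => hP.zsmul _ (hP.mul_right _ (hF _))
  der := by
    rintro i F X ⟨⟨M, hM⟩, hF⟩
    refine ⟨⟨M, fun m hm => ⟨fun s => ?_, ?_⟩⟩, fun m => hP.der i (hF m)⟩
    · rw [coeff_extendDer, (hM m hm).1 s, map_zero]
    · rw [coeff_extendDer, (hM m hm).2, map_zero]

end PsDO

/-! ### Iterated Laurent series as operators with constant coefficients. -/

namespace PseudoDiff

variable {k : Type u} [Field k]

/-- The monomial `a z₁ ^ α₁ ⋯ zⱼ ^ αⱼ`. -/
noncomputable def laurentMonomial : (j : ℕ) → (Fin j → ℤ) → k → IterLaurent k j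
  | 0, _, a => a
  | j + 1, α, a => (HahnSeries.single (α (Fin.last j))
      (laurentMonomial j (fun i => α i.castSucc) a) : LaurentSeries (IterLaurent k j))

theorem laurentMonomial_one : (j : ℕ) → laurentMonomial j 0 (1 : k) = 1
  | 0 => rfl
  | j + 1 => (congrArg (fun x : IterLaurent k j => (HahnSeries.single 0 x :
      LaurentSeries (IterLaurent k j))) (laurentMonomial_one j)).trans HahnSeries.single_zero_one

theorem laurentMonomial_mul : (j : ℕ) → (α β : Fin j → ℤ) → (a b : k) →
    laurentMonomial j α a * laurentMonomial j β b = laurentMonomial j (α + β) (a * b)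
  | 0, _, _, _, _ => rfl
  | j + 1, α, β, a, b => (HahnSeries.single_mul_single (R := IterLaurent k j)).trans
      (congrArg (fun x : IterLaurent k j => (HahnSeries.single (α (Fin.last j) + β (Fin.last j)) x :
        LaurentSeries (IterLaurent k j))) (laurentMonomial_mul j _ _ a b))

theorem laurentMonomial_zero : (j : ℕ) → (α : Fin j → ℤ) → laurentMonomial j α (0 : k) = 0
  | 0, _ => rfl
  | j + 1, α => (congrArg (fun x : IterLaurent k j => (HahnSeries.single (α (Fin.last j)) x :
      LaurentSeries (IterLaurent k j))) (laurentMonomial_zero j _)).trans (map_zero _)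

end PseudoDiff

namespace DiffRing

/-- The operator `a ∂ᵢ ^ m` in `R((∂ᵢ⁻¹))`. -/
noncomputable def psdoSingle {ι : Type v} (R : DiffRing.{u} ι) (i : ι) (m : ℤ) (a : R.carrier) :
    (R.psdo i).carrier :=
  PsDO.single (d := R.der i) m a

/-- The embedding of Laurent series into `R((∂ᵢ⁻¹))` given by an embedding of constants into `R`. -/
noncomputable def ofLaurent {ι : Type v} (R : DiffRing.{u} ι) (l : ι) {K : Type u} [Field K]
    (ψ : {ψ : K →+* R.carrier // ∀ i c, R.der i (ψ c) = 0}) :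
    {ψ : LaurentSeries K →+* (R.psdo l).carrier // ∀ i c, (R.psdo l).der i (ψ c) = 0} :=
  ⟨PsDO.ofLaurent ψ.1 (ψ.2 l), fun i c => PsDO.ext (d := R.der l) fun m => ψ.2 i (HahnSeries.coeff c (-m))⟩

/-- The embedding `zᵢ ↦ ∂ᵢ⁻¹` of iterated Laurent series as operators with constant coefficients. -/
noncomputable def ofIterLaurentAux (k : Type u) [Field k] (n : ℕ) : (j : ℕ) → (h : j ≤ n) →
    {ψ : PseudoDiff.IterLaurent k j →+* ((powerSeries k n).iter j h).carrier //
      ∀ i c, ((powerSeries k n).iter j h).der i (ψ c) = 0}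
  | 0, _ => ⟨(MvPowerSeries.C : k →+* MvPowerSeries (Fin n) k), fun i c =>
      MvPowerSeries.pderiv_C (R := k) (i := i) (r := c)⟩
  | j + 1, h => ofLaurent ((powerSeries k n).iter j (Nat.le_of_succ_le h)) ⟨j, h⟩
      (K := PseudoDiff.IterLaurent k j) (ofIterLaurentAux k n j (Nat.le_of_succ_le h))

/-- The embedding `zᵢ ↦ ∂ᵢ⁻¹` of iterated Laurent series as operators with constant coefficients. -/
noncomputable def ofIterLaurent (k : Type u) [Field k] (n j : ℕ) (h : j ≤ n) :
    PseudoDiff.IterLaurent k j →+* ((powerSeries k n).iter j h).carrier :=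
  (ofIterLaurentAux k n j h).1

theorem mem_range_ofLaurent {ι : Type v} (R : DiffRing.{u} ι) (l : ι) {K : Type u} [Field K]
    (ψ : {ψ : K →+* R.carrier // ∀ i c, R.der i (ψ c) = 0})
    (hψ : ∀ f, (∀ i, R.der i f = 0) → f ∈ Set.range ψ.1) (f : (R.psdo l).carrier)
    (hf : ∀ i, (R.psdo l).der i f = 0) : f ∈ Set.range (ofLaurent R l ψ).1 :=
  PsDO.mem_range_ofLaurent ψ.1 (ψ.2 l) f fun m =>
    hψ _ fun i => congrArg (fun X : PsDO (R.der l) => X.coeff m) (hf i)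

/-- The coefficient at `p + eᵢ`, multiplied by the nonzero integer `p i + 1`, is a coefficient of
`∂f/∂xᵢ`. -/
theorem mem_range_C_of_pderiv_eq_zero {k : Type u} [Field k] [CharZero k] {σ : Type*}
    (f : MvPowerSeries σ k) (hf : ∀ i, MvPowerSeries.pderiv k i f = 0) :
    f ∈ Set.range (MvPowerSeries.C : k →+* MvPowerSeries σ k) := by
  classical
  refine ⟨MvPowerSeries.coeff 0 f, ?_⟩
  ext m
  rw [MvPowerSeries.coeff_C]
  split_ifs with h
  · rw [h]
  obtain ⟨i, hi⟩ := Finsupp.ne_iff.mp h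
  obtain ⟨p, rfl⟩ : ∃ p, m = p + Finsupp.single i 1 :=
    ⟨m - Finsupp.single i 1, (tsub_add_cancel_of_le (by
      simpa [Finsupp.single_le_iff] using Nat.one_le_iff_ne_zero.mpr hi)).symm⟩
  have := congrArg (MvPowerSeries.coeff p) (hf i)
  rw [MvPowerSeries.coeff_pderiv, map_zero] at this
  exact ((mul_eq_zero.mp this).resolve_right (Nat.cast_add_one_ne_zero _)).symm

/-- The operators that are killed by all derivations have constant coefficients. -/
theorem mem_range_ofIterLaurent (k : Type u) [Field k] [CharZero k] (n j : ℕ) (h : j ≤ n)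
    (f : ((powerSeries k n).iter j h).carrier)
    (hf : ∀ i, ((powerSeries k n).iter j h).der i f = 0) :
    f ∈ Set.range (ofIterLaurent k n j h) := by
  induction j with
  | zero => exact mem_range_C_of_pderiv_eq_zero (k := k) (σ := Fin n) f hf
  | succ j ih => exact mem_range_ofLaurent _ _ _ (ih (Nat.le_of_succ_le h)) f hf

theorem ofIterLaurent_single (k : Type u) [Field k] (n j : ℕ) (h : j + 1 ≤ n) (i : ℤ)
    (c : PseudoDiff.IterLaurent k j) :
    ofIterLaurent k n (j + 1) h
      (HahnSeries.single i c : LaurentSeries (PseudoDiff.IterLaurent k j)) =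
    ((powerSeries k n).iter j (Nat.le_of_succ_le h)).psdoSingle ⟨j, h⟩ (-i)
      (ofIterLaurent k n j (Nat.le_of_succ_le h) c) :=
  PsDO.ofLaurent_single _ ((ofIterLaurentAux k n j (Nat.le_of_succ_le h)).2 ⟨j, h⟩) i c

theorem der_ofIterLaurent (k : Type u) [Field k] (n j : ℕ) (h : j ≤ n) (i : Fin n)
    (c : PseudoDiff.IterLaurent k j) :
    ((powerSeries k n).iter j h).der i (ofIterLaurent k n j h c) = 0 :=
  (ofIterLaurentAux k n j h).2 i c

/-- The exponent changes sign because `zᵢ ↦ ∂ᵢ⁻¹`. Viewing the `∂ᵢ` as images of Laurent monomials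
makes them commuting units at no cost. -/
theorem monomial_one (k : Type u) [Field k] (n j : ℕ) (h : j ≤ n) (α : Fin j → ℤ) :
    (powerSeries k n).monomial j h α (1 : MvPowerSeries (Fin n) k) =
      ofIterLaurent k n j h (PseudoDiff.laurentMonomial j (-α) 1) := by
  induction j with
  | zero => exact (map_one (MvPowerSeries.C : k →+* MvPowerSeries (Fin n) k)).symm
  | succ j ih =>
    refine Eq.trans ?_ (ofIterLaurent_single k n j h _ _).symm
    change psdoSingle _ _ (α (Fin.last j)) _ = psdoSingle _ _ (- -α (Fin.last j)) _
    rw [ih, neg_neg]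
    rfl

end DiffRing

/-! ### Commutators with `∂ᵢ` and with scalars. -/

namespace PsDO

variable {A : Type u} [Ring A] {d : RingDer A}

theorem single_zero_comm {x : A} (hd : d x = 0) (f : PsDO d)
    (hx : ∀ m, x * f.coeff m = f.coeff m * x) : single 0 x * f = f * single 0 x :=
  ext fun m => by rw [coeff_single_zero_mul, coeff_mul_single_zero _ hd, hx]

theorem commutator_single_zero {ι : Type v} {D : ι → RingDer A} {l : ι}
    (hD : ∀ i j a, D i (D j a) = D j (D i a)) {i : ι} {x : A} (hd : D l x = 0)
    (hx : ∀ f, x * f - f * x = D i f) (f : PsDO (D l)) :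
    single 0 x * f - f * single 0 x = extendDer (D i) (hD i l) f :=
  ext fun m => by
    rw [coeff_sub, coeff_single_zero_mul, coeff_mul_single_zero _ hd, hx, coeff_extendDer]

end PsDO

namespace DiffRing

theorem psdo_commutator_castSucc {ι : Type v} (R : DiffRing.{u} ι) (l i : ι) {x : R.carrier}
    (hd : R.der l x = 0) (hx : ∀ f, x * f - f * x = R.der i f) (f : (R.psdo l).carrier) :
    R.psdoSingle l 0 x * f -
      f * R.psdoSingle l 0 x = (R.psdo l).der i f :=
  PsDO.commutator_single_zero R.comm hd hx f

theorem psdo_commutator_last {ι : Type v} (R : DiffRing.{u} ι) (l : ι) (f : (R.psdo l).carrier) :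
    R.psdoSingle l 1 1 * f -
      f * R.psdoSingle l 1 1 = (R.psdo l).der l f :=
  PsDO.ext (d := R.der l) fun m => PsDO.single_one_mul_sub (d := R.der l) f m

theorem psdo_comm_single_zero {ι : Type v} (R : DiffRing.{u} ι) (l : ι) {x : R.carrier}
    (hd : R.der l x = 0) (hx : ∀ f, x * f = f * x) (f : (R.psdo l).carrier) :
    R.psdoSingle l 0 x * f =
      f * R.psdoSingle l 0 x :=
  PsDO.single_zero_comm hd f fun _ => hx _

/-- `[∂ᵢ, f] = ∂f/∂xᵢ`. -/
theorem commutator_ofIterLaurent (k : Type u) [Field k] (n j : ℕ) (h : j ≤ n) (i : Fin j)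
    (f : ((powerSeries k n).iter j h).carrier) :
    ofIterLaurent k n j h (PseudoDiff.laurentMonomial j (-Pi.single i 1) 1) * f -
      f * ofIterLaurent k n j h (PseudoDiff.laurentMonomial j (-Pi.single i 1) 1) =
      ((powerSeries k n).iter j h).der (Fin.castLE h i) f := by
  induction j with
  | zero => exact i.elim0
  | succ j ih =>
    have e : ofIterLaurent k n (j + 1) h
        (PseudoDiff.laurentMonomial (j + 1) (-Pi.single i 1) 1) = _ :=
      ofIterLaurent_single k n j h _ _
    rw [e]
    clear e
    -- The last `∂` is the one just adjoined. An earlier `∂ᵢ` is an operator of order zero whose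
    -- coefficient is the `∂ᵢ` of the previous stage, so its commutator is computed coefficientwise.
    induction i using Fin.lastCases with
    | last =>
      have e1 : (fun i : Fin j => (-Pi.single (Fin.last j) 1 : Fin (j + 1) → ℤ) i.castSucc) = 0 := by
        funext i
        simp [(Fin.castSucc_lt_last i).ne]
      rw [e1, PseudoDiff.laurentMonomial_one, map_one, Pi.neg_apply, neg_neg, Pi.single_eq_same]
      exact psdo_commutator_last _ _ f
    | cast i =>
      have e1 : (fun l : Fin j => (-Pi.single i.castSucc 1 : Fin (j + 1) → ℤ) l.castSucc) =
          -Pi.single i 1 := by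
        funext l
        simp [Pi.single_apply]
      rw [e1, Pi.neg_apply, neg_neg, Pi.single_eq_of_ne (Fin.castSucc_lt_last i).ne']
      exact psdo_commutator_castSucc _ _ _ (der_ofIterLaurent _ _ _ _ _ _)
        (ih (Nat.le_of_succ_le h) i) f

theorem ofIterLaurent_const_succ (k : Type u) [Field k] (n j : ℕ) (h : j + 1 ≤ n) (a : k) :
    ofIterLaurent k n (j + 1) h (PseudoDiff.laurentMonomial (j + 1) 0 a) =
    ((powerSeries k n).iter j (Nat.le_of_succ_le h)).psdoSingle ⟨j, h⟩ 0
      (ofIterLaurent k n j (Nat.le_of_succ_le h) (PseudoDiff.laurentMonomial j 0 a)) :=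
  ofIterLaurent_single k n j h _ _

theorem ofIterLaurent_const_comm (k : Type u) [Field k] (n j : ℕ) (h : j ≤ n) (a : k)
    (f : ((powerSeries k n).iter j h).carrier) :
    ofIterLaurent k n j h (PseudoDiff.laurentMonomial j 0 a) * f =
      f * ofIterLaurent k n j h (PseudoDiff.laurentMonomial j 0 a) := by
  induction j with
  | zero => exact mul_comm (G := MvPowerSeries (Fin n) k) _ _
  | succ j ih =>
    rw [ofIterLaurent_const_succ]
    exact psdo_comm_single_zero _ _ (der_ofIterLaurent _ _ _ _ _ _) (ih _) f

theorem coeff_ofIterLaurent_const_mul (k : Type u) [Field k] (n j : ℕ) (h : j ≤ n) (a : k)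
    (f : ((powerSeries k n).iter j h).carrier) (β : Fin j → ℤ) :
    (powerSeries k n).coeff j h (ofIterLaurent k n j h (PseudoDiff.laurentMonomial j 0 a) * f) β =
      HSMul.hSMul (β := MvPowerSeries (Fin n) k) a ((powerSeries k n).coeff j h f β) := by
  induction j with
  | zero => exact (MvPowerSeries.smul_eq_C_mul f a).symm
  | succ j ih =>
    rw [ofIterLaurent_const_succ]
    refine Eq.trans ?_ (ih (Nat.le_of_succ_le h) _ _)
    exact congrArg (fun X => (powerSeries k n).coeff j (Nat.le_of_succ_le h) X _)
      (PsDO.coeff_single_zero_mul (d := ((powerSeries k n).iter j _).der ⟨j, h⟩) _ f _)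

end DiffRing

-- Expansion of an iterated Laurent series into its terms.

universe w

theorem isSummation_finsum {ι : Type v} {A : Type u} [Ring A] (D : ι → RingDer A) {I : Type w} :
    IsSummation D (fun (F : I → A) X => (Function.support F).Finite ∧ X = ∑ᶠ s, F s) where
  zero := ⟨by simp, by simp⟩
  add := by
    rintro F G X Y ⟨hF, rfl⟩ ⟨hG, rfl⟩
    exact ⟨(hF.union hG).subset (Function.support_add F G), (finsum_add_distrib hF hG).symm⟩
  mul_left := by
    rintro a F X ⟨hF, rfl⟩
    exact ⟨hF.subset fun s hs h => hs (by simp [h]), mul_finsum' _ _ hF⟩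
  mul_right := by
    rintro a F X ⟨hF, rfl⟩
    exact ⟨hF.subset fun s hs h => hs (by simp [h]), finsum_mul' _ _ hF⟩
  der := by
    rintro i F X ⟨hF, rfl⟩
    exact ⟨hF.subset fun s hs h => hs (by simp [h]),
      AddMonoidHom.map_finsum (D i).toAddMonoidHom hF⟩

theorem PsDO.nontrivial {A : Type u} [Ring A] [Nontrivial A] {d : RingDer A} :
    Nontrivial (PsDO d) := by
  refine ⟨1, 0, fun h => one_ne_zero (α := A) ?_⟩
  have := congrArg (fun f : PsDO d => f.coeff 0) h
  simp [PsDO.one_def, PsDO.coeff_single] at this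

theorem PseudoDiff.laurentCoeff_zero {k : Type u} [Field k] : (j : ℕ) → (α : Fin j → ℤ) →
    PseudoDiff.laurentCoeff j (0 : PseudoDiff.IterLaurent k j) α = 0
  | 0, _ => rfl
  | j + 1, _ => PseudoDiff.laurentCoeff_zero j _

namespace DiffRing

/-- Summation of families in `R((∂₁⁻¹))…((∂ⱼ⁻¹))`, coefficientwise and, at each stage, with
uniformly bounded orders. -/
def SumsTo {n : ℕ} (R : DiffRing.{u} (Fin n)) {I : Type w} : (j : ℕ) → (h : j ≤ n) →
    (I → (R.iter j h).carrier) → (R.iter j h).carrier → Prop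
  | 0, _ => fun (F : I → R.carrier) X => (Function.support F).Finite ∧ X = ∑ᶠ s, F s
  | j + 1, h => PsDO.SumsTo (d := (R.iter j (Nat.le_of_succ_le h)).der ⟨j, h⟩)
      (SumsTo R j (Nat.le_of_succ_le h))

theorem isSummation_psdo {ι : Type v} (R : DiffRing.{u} ι) (l : ι) {I : Type w}
    {P : (I → R.carrier) → R.carrier → Prop} (hP : IsSummation R.der P) :
    IsSummation (R.psdo l).der (PsDO.SumsTo (d := R.der l) P) :=
  PsDO.isSummation_sumsTo R.comm hP

theorem isSummation_sumsTo {n : ℕ} (R : DiffRing.{u} (Fin n)) (I : Type w) (j : ℕ) (h : j ≤ n) :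
    IsSummation (R.iter j h).der (R.SumsTo (I := I) j h) := by
  induction j with
  | zero => exact isSummation_finsum R.der
  | succ j ih =>
    exact isSummation_psdo (R.iter j (Nat.le_of_succ_le h)) ⟨j, h⟩ (ih (Nat.le_of_succ_le h))

/-- For a family indexed by exponents, this restricts the sum to the slice with a fixed last
exponent, the only one that contributes to a given coefficient. -/
theorem SumsTo.reindex {n : ℕ} (R : DiffRing.{u} (Fin n)) {I I' : Type w} (e : I → I')
    (he : Function.Injective e) (j : ℕ) (h : j ≤ n) {F : I' → (R.iter j h).carrier}
    {X : (R.iter j h).carrier} (h0 : ∀ s, s ∉ Set.range e → F s = 0)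
    (hF : R.SumsTo j h (F ∘ e) X) : R.SumsTo j h F X := by
  induction j with
  | zero =>
    obtain ⟨h1, h2⟩ := hF
    refine ⟨(h1.image e).subset fun s hs => ?_, h2.trans (finsum_eq_comp F e he h0).symm⟩
    by_cases hr : s ∈ Set.range e
    · obtain ⟨t, rfl⟩ := hr
      exact ⟨t, hs, rfl⟩
    · exact absurd (h0 s hr) hs
  | succ j ih =>
    obtain ⟨⟨N, hN⟩, h2⟩ := hF
    refine ⟨⟨N, fun m hm => ⟨fun s => ?_, (hN m hm).2⟩⟩, fun m => ?_⟩
    · by_cases hr : s ∈ Set.range e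
      · obtain ⟨t, rfl⟩ := hr
        exact (hN m hm).1 t
      · rw [h0 s hr]; rfl
    · exact ih (Nat.le_of_succ_le h) (fun s hr => by rw [h0 s hr]; rfl) (h2 m)

theorem SumsTo.coeff {n : ℕ} (R : DiffRing.{u} (Fin n)) {I : Type w} (j : ℕ) (h : j ≤ n)
    {F : I → (R.iter j h).carrier} {X : (R.iter j h).carrier} (hF : R.SumsTo j h F X)
    (β : Fin j → ℤ) : {s | R.coeff j h (F s) β ≠ 0}.Finite ∧
      R.coeff j h X β = ∑ᶠ s, R.coeff j h (F s) β := by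
  induction j with
  | zero => exact hF
  | succ j ih => exact ih (Nat.le_of_succ_le h) (hF.2 (β (Fin.last j))) _

theorem coeff_ext {n : ℕ} (R : DiffRing.{u} (Fin n)) (j : ℕ) (h : j ≤ n)
    {X Y : (R.iter j h).carrier} (hXY : ∀ β, R.coeff j h X β = R.coeff j h Y β) : X = Y := by
  induction j with
  | zero => exact hXY 0
  | succ j ih =>
    refine PsDO.ext (d := (R.iter j (Nat.le_of_succ_le h)).der ⟨j, h⟩) fun m => ?_
    refine ih (Nat.le_of_succ_le h) fun β => ?_
    have := hXY (Fin.snoc β m)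
    simp only [DiffRing.coeff, Fin.snoc_last, Fin.snoc_castSucc] at this
    exact this

theorem nontrivial_iter (k : Type u) [Field k] (n j : ℕ) (h : j ≤ n) :
    Nontrivial ((powerSeries k n).iter j h).carrier := by
  induction j with
  | zero => exact inferInstanceAs (Nontrivial (MvPowerSeries (Fin n) k))
  | succ j ih =>
    have := ih (Nat.le_of_succ_le h)
    exact PsDO.nontrivial (d := ((powerSeries k n).iter j (Nat.le_of_succ_le h)).der ⟨j, h⟩)

/-- Injectivity pulls the order bound of the image operator back to the coefficients of the series
in `sumsTo_ofIterLaurent`. -/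
theorem ofIterLaurent_injective (k : Type u) [Field k] (n j : ℕ) (h : j ≤ n) :
    Function.Injective (ofIterLaurent k n j h) :=
  have := nontrivial_iter k n j h
  (ofIterLaurent k n j h).injective

/-- The terms of an iterated Laurent series, with `zᵢ` replaced by `∂ᵢ⁻¹`, sum to the operator with
constant coefficients that it defines. -/
theorem sumsTo_ofIterLaurent (k : Type u) [Field k] (n j : ℕ) (h : j ≤ n)
    (c : PseudoDiff.IterLaurent k j) :
    (powerSeries k n).SumsTo j h (fun α => ofIterLaurent k n j h
      (PseudoDiff.laurentMonomial j α (PseudoDiff.laurentCoeff j c α)))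
      (ofIterLaurent k n j h c) := by
  induction j with
  | zero =>
    refine ⟨Set.toFinite _, ?_⟩
    exact (finsum_unique (M := MvPowerSeries (Fin n) k)
      (fun α : Fin 0 → ℤ => ofIterLaurent k n 0 h c)).symm
  | succ j ih =>
    have hF : ∀ (m : ℤ) (α : Fin (j + 1) → ℤ),
        PsDO.coeff (d := ((powerSeries k n).iter j (Nat.le_of_succ_le h)).der ⟨j, h⟩)
          (ofIterLaurent k n (j + 1) h (PseudoDiff.laurentMonomial (j + 1) α
            (PseudoDiff.laurentCoeff (j + 1) c α))) m =
        if m = -α (Fin.last j) then ofIterLaurent k n j (Nat.le_of_succ_le h)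
          (PseudoDiff.laurentMonomial j (fun i => α i.castSucc)
            (PseudoDiff.laurentCoeff (j + 1) c α)) else 0 := fun m α =>
      congrArg (fun X => PsDO.coeff
        (d := ((powerSeries k n).iter j (Nat.le_of_succ_le h)).der ⟨j, h⟩) X m)
        (ofIterLaurent_single k n j h _ _)
    have hX : ∀ m : ℤ,
        PsDO.coeff (d := ((powerSeries k n).iter j (Nat.le_of_succ_le h)).der ⟨j, h⟩)
          (ofIterLaurent k n (j + 1) h c) m = ofIterLaurent k n j (Nat.le_of_succ_le h)
            (HahnSeries.coeff (Γ := ℤ) (R := PseudoDiff.IterLaurent k j) c (-m)) := fun m => rfl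
    obtain ⟨N, hN⟩ := PsDO.bdd
      (d := ((powerSeries k n).iter j (Nat.le_of_succ_le h)).der ⟨j, h⟩)
      (ofIterLaurent k n (j + 1) h c)
    have hc : ∀ m, N < m →
        HahnSeries.coeff (Γ := ℤ) (R := PseudoDiff.IterLaurent k j) c (-m) = 0 := fun m hm =>
      ofIterLaurent_injective k n j (Nat.le_of_succ_le h) ((hN m hm).trans (map_zero _).symm)
    refine ⟨⟨N, fun m hm => ⟨fun α => ?_, hN m hm⟩⟩, fun m => ?_⟩
    · rw [hF]
      split_ifs with hα
      · subst hα
        have e : PseudoDiff.laurentCoeff (j + 1) c α = 0 := by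
          have := hc _ hm
          rw [neg_neg] at this
          change PseudoDiff.laurentCoeff j (HahnSeries.coeff (Γ := ℤ)
            (R := PseudoDiff.IterLaurent k j) c (α (Fin.last j))) _ = 0
          rw [this, PseudoDiff.laurentCoeff_zero]
        rw [e, PseudoDiff.laurentMonomial_zero, map_zero]
      · rfl
    · simp only [hF, hX]
      -- Since the last `z` is sent to the inverse of the last `∂`, order `m` receives exactly the
      -- terms with last exponent `-m`.
      refine SumsTo.reindex _ (fun α : Fin j → ℤ => (Fin.snoc α (-m) : Fin (j + 1) → ℤ)) ?_ j _ ?_ ?_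
      · intro α β hαβ
        simpa using congrArg (fun γ : Fin (j + 1) → ℤ => fun i : Fin j => γ i.castSucc) hαβ
      · intro α hα
        refine if_neg fun hm => hα ⟨fun i => α i.castSucc, ?_⟩
        funext i
        induction i using Fin.lastCases with
        | last => simp [hm]
        | cast i => simp
      · have := ih (Nat.le_of_succ_le h)
          (HahnSeries.coeff (Γ := ℤ) (R := PseudoDiff.IterLaurent k j) c (-m))
        convert this using 1
        funext α
        simp [PseudoDiff.laurentCoeff]

end DiffRing

/-! ### Conjugating commuting operators to the `∂ᵢ`. -/

namespace DiffRing

/-- If the operators `x i + T i` commute, where `[x i, f] = D i f` and the orders of the `T i` are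
negative, then they are simultaneously conjugate to the `x i`. -/
theorem exists_conjugation {ι : Type v} [Finite ι] (R : DiffRing.{u} ι)
    (hR : ∃ J, IsPrimitive R.der J) (l : ι) (x L : ι → (R.psdo l).carrier)
    (hx : ∀ i f, x i * f - f * x i = (R.psdo l).der i f) (hxx : ∀ i j, x i * x j = x j * x i)
    (hL : ∀ i m, 0 ≤ m → PsDO.coeff (d := R.der l) (L i - x i) m = 0)
    (hcomm : ∀ i j, L i * L j = L j * L i) :
    ∃ S : (R.psdo l).carrierˣ, ∀ i, L i * S = S * x i := by
  obtain ⟨J, hJ⟩ := hR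
  obtain ⟨S, hS⟩ : ∃ S : (R.psdo l).carrierˣ, ∀ i, (R.psdo l).der i S = -((L i - x i) * S) := by
    refine PsDO.exists_dressing R.comm hJ (fun i => L i - x i) hL fun i j => ?_
    change (R.psdo l).der i (L j - x j) + (L i - x i) * (L j - x j) =
      (R.psdo l).der j (L i - x i) + (L j - x j) * (L i - x i)
    rw [← hx, ← hx, ← sub_eq_zero]
    -- With derivations written as commutators with `x i`, the curvature of the connection is `[Lᵢ,
    -- Lⱼ] - [xᵢ, xⱼ]`.
    calc _ = (L i * L j - L j * L i) - (x i * x j - x j * x i) := by noncomm_ring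
      _ = 0 := by rw [hcomm i j, hxx i j]; simp
  refine ⟨S, fun i => ?_⟩
  have := hS i
  rw [← hx, sub_mul, neg_sub] at this
  exact (sub_right_injective this).symm

end DiffRing

/-! ### The centralizer and its series in `E`. -/

namespace PseudoDiff

variable {k : Type u} [Field k] {n : ℕ}

/-- The embedding `zᵢ ↦ ∂ᵢ⁻¹` of iterated Laurent series as operators with constant coefficients. -/
noncomputable def ofLaurent (k : Type u) [Field k] (n : ℕ) : IterLaurent k n →+* E k n :=
  DiffRing.ofIterLaurent k n n le_rfl

theorem del_eq (i : Fin n) : (del i : E k n) = ofLaurent k n (laurentMonomial n (-Pi.single i 1) 1) :=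
  DiffRing.monomial_one k n n le_rfl _

theorem del_mul_sub (i : Fin n) (f : E k n) :
    del i * f - f * del i = ((DiffRing.powerSeries k n).iter n le_rfl).der i f := by
  rw [del_eq]
  exact DiffRing.commutator_ofIterLaurent k n n le_rfl i f

theorem del_comm (i j : Fin n) : (del i * del j : E k n) = del j * del i := by
  rw [del_eq, del_eq, ← map_mul, mul_comm, map_mul]

theorem mem_range_ofLaurent [CharZero k] (f : E k n) (hf : ∀ i, del i * f = f * del i) :
    f ∈ Set.range (ofLaurent k n) :=
  DiffRing.mem_range_ofIterLaurent k n n le_rfl f fun i =>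
    (del_mul_sub i f).symm.trans (sub_eq_zero.mpr (hf i))

/-- `E` is `R((∂⁻¹))` over the ring `R` of the stage before the last, and `EMinus` means negative
order in this last `∂`. Primitives are needed in `R` for all `n + 1` derivations, including that of
the last variable. -/
theorem exists_conjugation [CharZero k] (L : Fin (n + 1) → E k (n + 1))
    (hL : ∀ i, L i - del i ∈ EMinus k n) (hcomm : ∀ i j, L i * L j = L j * L i) :
    ∃ S : (E k (n + 1))ˣ, ∀ i, L i * (S : E k (n + 1)) = (S : E k (n + 1)) * del i :=
  DiffRing.exists_conjugation ((DiffRing.powerSeries k (n + 1)).iter n (Nat.le_succ n))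
    (DiffRing.exists_isPrimitive_iter _ (DiffRing.exists_isPrimitive_powerSeries k (n + 1)) n _)
    (Fin.last n) (del (k := k)) L del_mul_sub del_comm hL hcomm

theorem ext {X Y : E k n} (h : ∀ β, coeff X β = coeff Y β) : X = Y :=
  DiffRing.coeff_ext (DiffRing.powerSeries k n) n le_rfl h

/-- The monomials of iterated Laurent series as units. -/
noncomputable def laurentMonomialHom (k : Type u) [Field k] (n : ℕ) :
    Multiplicative (Fin n → ℤ) →* (IterLaurent k n)ˣ :=
  MonoidHom.toHomUnits
    { toFun := fun α => laurentMonomial n α.toAdd 1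
      map_one' := laurentMonomial_one n
      map_mul' := fun α β => by
        rw [laurentMonomial_mul, one_mul]; rfl }

/-- The unit `S ∂ᵢ S⁻¹`. -/
noncomputable def conjDel (S : (E k n)ˣ) (i : Fin n) : (E k n)ˣ :=
  MulAut.conj S (Units.map (ofLaurent k n).toMonoidHom
    (laurentMonomialHom k n (Multiplicative.ofAdd (-Pi.single i 1))))

theorem coe_conjDel (S : (E k n)ˣ) (i : Fin n) :
    (conjDel S i : E k n) = (S : E k n) * del i * ((S⁻¹ : (E k n)ˣ) : E k n) := by
  rw [del_eq]; rfl

/-- All factors are values of one homomorphism `G` on the commutative group of exponents, so the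
ordered product is the value of `G` at the sum of the exponents. -/
theorem zpowProd_conjDel (S : (E k n)ˣ) (α : Fin n → ℤ) :
    (zpowProd (conjDel S) (-α) : E k n) =
      (S : E k n) * ofLaurent k n (laurentMonomial n α 1) * ((S⁻¹ : (E k n)ˣ) : E k n) := by
  let G : Multiplicative (Fin n → ℤ) →* (E k n)ˣ := (MulAut.conj S).toMonoidHom.comp
    ((Units.map (ofLaurent k n).toMonoidHom).comp (laurentMonomialHom k n))
  have h : zpowProd (conjDel S) (-α) = G (Multiplicative.ofAdd α) := by
    -- Two signs cancel: `∂ᵢ` corresponds to the exponent `-eᵢ`, and it is raised to the power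
    -- `-αᵢ`.
    have h1 : Multiplicative.ofAdd α =
        (List.ofFn fun i => Multiplicative.ofAdd (-Pi.single i 1 : Fin n → ℤ) ^ (-α) i).prod := by
      rw [List.prod_ofFn]
      apply Multiplicative.toAdd.injective
      rw [toAdd_prod]
      simp only [toAdd_zpow, toAdd_ofAdd]
      conv_lhs => rw [← Finset.univ_sum_single α]
      refine Finset.sum_congr rfl fun i _ => ?_
      funext l
      by_cases h : l = i <;> simp [h]
    rw [h1, map_list_prod, List.map_ofFn, zpowProd]
    congr 2
    funext i
    exact (map_zpow G _ _).symm
  rw [h]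
  rfl

/-- Scalars from `k` are central in `E`, so they pass through `S` and act on the coefficients. -/
theorem coeff_laurentMonomial_mul (S : (E k n)ˣ) (a : k) (α β : Fin n → ℤ) :
    coeff ((S : E k n) * ofLaurent k n (laurentMonomial n α a) * ((S⁻¹ : (E k n)ˣ) : E k n)) β =
      a • coeff ((S : E k n) * ofLaurent k n (laurentMonomial n α 1) * ((S⁻¹ : (E k n)ˣ) : E k n)) β := by
  have hc : ∀ f : E k n, ofLaurent k n (laurentMonomial n 0 a) * f =
      f * ofLaurent k n (laurentMonomial n 0 a) := DiffRing.ofIterLaurent_const_comm k n n le_rfl a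
  have h1 : laurentMonomial n α a = laurentMonomial n 0 a * laurentMonomial n α 1 := by
    rw [laurentMonomial_mul, zero_add, mul_one]
  rw [h1, map_mul, ← mul_assoc, ← hc, mul_assoc, mul_assoc, ← mul_assoc (S : E k n)]
  exact DiffRing.coeff_ofIterLaurent_const_mul k n n le_rfl a _ β

/-- The substitution `zᵢ ↦ S ∂ᵢ⁻¹ S⁻¹`. -/
noncomputable def conjLaurent (S : (E k n)ˣ) : IterLaurent k n →+* E k n :=
  ((MulSemiringAction.toRingHom (ConjAct (E k n)ˣ) (E k n)) (ConjAct.toConjAct S)).comp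
    (ofLaurent k n)

theorem conjLaurent_apply (S : (E k n)ˣ) (c : IterLaurent k n) :
    conjLaurent S c = (S : E k n) * ofLaurent k n c * ((S⁻¹ : (E k n)ˣ) : E k n) := rfl

/-- For `S = 1` this is the expansion `sumsTo_ofIterLaurent`. Multiplication by `S` and by `S⁻¹`
preserves `SumsTo`, and coefficients are taken only at the end. -/
theorem isLaurentSum_conjLaurent (S : (E k n)ˣ) (c : IterLaurent k n) :
    IsLaurentSum (conjDel S) c (conjLaurent S c) := by
  intro β
  have hP := DiffRing.isSummation_sumsTo (DiffRing.powerSeries k n) (Fin n → ℤ) n le_rfl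
  have h := DiffRing.SumsTo.coeff _ n le_rfl (hP.mul_right ((S⁻¹ : (E k n)ˣ) : E k n)
    (hP.mul_left (S : E k n) (DiffRing.sumsTo_ofIterLaurent k n n le_rfl c))) β
  have e : ∀ α, laurentCoeff n c α • coeff (zpowProd (conjDel S) (-α) : E k n) β =
      coeff ((S : E k n) * ofLaurent k n (laurentMonomial n α (laurentCoeff n c α)) *
        ((S⁻¹ : (E k n)ˣ) : E k n)) β := fun α => by
    rw [zpowProd_conjDel]
    exact (coeff_laurentMonomial_mul S _ α β).symm
  simp only [e]
  exact h

theorem laurentIn_conjDel (S : (E k n)ˣ) :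
    laurentIn (conjDel S) = Set.range (conjLaurent S) := by
  refine Set.Subset.antisymm ?_ ?_
  · rintro X ⟨c, hc⟩
    exact ⟨c, ext fun β => ((isLaurentSum_conjLaurent S c β).2.trans (hc β).2.symm)⟩
  · rintro _ ⟨c, rfl⟩
    exact ⟨c, isLaurentSum_conjLaurent S c⟩

/-- `S⁻¹ X S` commutes with every `∂ᵢ`, hence has constant coefficients. Conversely, `S ∂ᵢ S⁻¹`
itself lies in the image of the commutative field of Laurent series. -/
theorem centralizer_conjDel [CharZero k] (S : (E k n)ˣ) :
    (Subring.centralizer (Set.range fun i => (conjDel S i : E k n)) : Set (E k n)) =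
      Set.range (conjLaurent S) := by
  ext X
  rw [SetLike.mem_coe, Subring.mem_centralizer_iff, Set.forall_mem_range]
  constructor
  · intro h
    obtain ⟨c, hc⟩ := mem_range_ofLaurent (((S⁻¹ : (E k n)ˣ) : E k n) * X * (S : E k n)) fun i => by
      have hi := h i
      rw [coe_conjDel] at hi
      have := congrArg (fun Y => ((S⁻¹ : (E k n)ˣ) : E k n) * Y * (S : E k n)) hi
      simpa [mul_assoc] using this
    refine ⟨c, ?_⟩
    rw [conjLaurent_apply, hc]
    simp [mul_assoc]
  · rintro ⟨c, rfl⟩ i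
    have : (conjDel S i : E k n) = conjLaurent S (laurentMonomial n (-Pi.single i 1) 1) := by
      rw [coe_conjDel, del_eq]; rfl
    rw [this, ← map_mul, mul_comm, map_mul]

end PseudoDiff

theorem corollary1 {k : Type*} [Field k] [CharZero k] (n : ℕ)
    (L : Fin (n + 1) → PseudoDiff.E k (n + 1))
    (hL : ∀ i, L i - PseudoDiff.del i ∈ PseudoDiff.EMinus k n)
    (hcomm : ∀ i j, L i * L j = L j * L i) :
    (∀ X ∈ Subring.centralizer (Set.range L), ∀ Y ∈ Subring.centralizer (Set.range L),
      X * Y = Y * X) ∧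
    ∃ U : Fin (n + 1) → (PseudoDiff.E k (n + 1))ˣ,
      (∀ i, (U i : PseudoDiff.E k (n + 1)) = L i) ∧
      (Subring.centralizer (Set.range L) : Set (PseudoDiff.E k (n + 1))) =
        PseudoDiff.laurentIn U ∧
      ∃ φ : PseudoDiff.IterLaurent k (n + 1) →+* PseudoDiff.E k (n + 1),
        ∀ c, PseudoDiff.IsLaurentSum U c (φ c) := by
  obtain ⟨S, hS⟩ := PseudoDiff.exists_conjugation L hL hcomm
  -- `Lᵢ S = S ∂ᵢ` gives `Lᵢ = S ∂ᵢ S⁻¹`, so invertibility of the `Lᵢ` comes from that of the `∂ᵢ`.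
  obtain rfl : (fun i => (PseudoDiff.conjDel S i : PseudoDiff.E k (n + 1))) = L := by
    funext i
    rw [PseudoDiff.coe_conjDel, ← hS, Units.mul_inv_cancel_right]
  have hZ := PseudoDiff.centralizer_conjDel S
  refine ⟨fun X hX Y hY => ?_, PseudoDiff.conjDel S, fun _ => rfl,
    hZ.trans (PseudoDiff.laurentIn_conjDel S).symm, PseudoDiff.conjLaurent S,
    PseudoDiff.isLaurentSum_conjLaurent S⟩
  rw [← SetLike.mem_coe, hZ] at hX hY
  obtain ⟨c, rfl⟩ := hX
  obtain ⟨e, rfl⟩ := hY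
  rw [← map_mul, mul_comm, map_mul]
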